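/- Let $S^1=\mathbb R/\mathbb Z$, let $n\ge 0$, and let $X:S^1\times\mathbb R^n\to\mathbb R^n$, $(t,y)\mapsto X_t(y)$, be a smooth time-dependent vector field. For $m\ge 0$ let $H_m=W^{m,2}(S^1,\mathbb R^n)$, so $H_0=L^2(S^1,\mathbb R^n)$, let $\partial_t:H_{m+1}\to H_m$ be the weak derivative, and let $\varphi(\tau,x)=x(\cdot-\tau)$ for $\tau\in\mathbb R$. A sc-Hilbert space $\mathrm E$ is a sequence of real Hilbert spaces $E_0\supseteq E_1\supseteq\cdots$ with compact and dense inclusions $E_{m+1}\hookrightarrow E_m$; $\mathrm E^1$ denotes $E_1$ with the filtration $(\mathrm E^1)_m=E_{m+1}$, and products are taken level by level. A map $f:\mathrm E\to\mathrm F$ is $sc^0$ if for every $m$ it maps $E_m$ to $F_m$ and $f:E_m\to F_m$ is continuous. A bounded operator $\mathrm df(x):E_0\to F_0$ is the sc-differential of $f$ at $x\in E_1$ if $$\lim_{h\in E_1,\ \|h\|_{E_1}\to 0}\frac{\|f(x+h)-f(x)-\mathrm df(x)h\|_{F_0}}{\|h\|_{E_1}}=0 .$$ The map $f$ is $sc^1$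 if it is $sc^0$, has a sc-differential at every $x\in E_1$, and its tangent map $Tf:\mathrm E^1\oplus\mathrm E\to\mathrm F^1\oplus\mathrm F$, $(x,h)\mapsto(f(x),\mathrm df(x)h)$, is $sc^0$. For $k\ge 2$ it is $sc^k$ if $f$ and $Tf$ are $sc^{k-1}$, and it is sc-smooth if it is $sc^k$ for every $k$. Let $\mathrm H=(H_m)_{m\ge 0}$, and give $\mathbb R$ the constant filtration. Let $$s:\mathbb R\times\mathrm H^1\to\mathrm H,\qquad s(\tau,x)=\partial_t x-X(\varphi(\tau,x)),\qquad X(y)(t)=X_t(y(t)),$$ and let $S(\tau,x)=(\tau,x,s(\tau,x))$ be the corresponding section of the trivial bundle $\mathbb R\times\mathrm H^1\times\mathrm H\to\mathbb R\times\mathrm H^1$. The vertical sc-differential of $S$ at a point is the sc-differential of its principal part $s$. **Proposition.** The section $S$ is sc-smooth. Its vertical sc-differential at a point $(\tau,x)\in(\mathbb R\times\mathrm H^1)_1=\mathbb R\times H_2$ is the map $\mathrm ds(\tau,x):\mathbb R\times H_1\to H_0$, $$\mathrm ds(\tau,x)(T,\hat x)=\partial_t\hat x-\mathrm dX(\varphi(\tau,x))\cdot\varphi(\tau,\hat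 x)+T\cdot \mathrm dX(\varphi(\tau,x))\cdot\varphi(\tau,\partial_t x),$$ where $(\mathrm dX(y)\cdot v)(t)=\mathrm dX_t(y(t))\,v(t)$ and $\mathrm dX_t$ is the derivative of $X_t:\mathbb R^n\to\mathbb R^n$. In particular, at $(0,x)$ with $x\in H_2$, $$\mathrm ds(0,x)(T,\hat x)=\partial_t\hat x-\mathrm dX(x)\cdot\hat x+T\cdot \mathrm dX(x)\cdot\partial_t x .$$ -/

import Mathlib

open scoped ContDiff Topology
open MeasureTheory

/-- A sc-Hilbert space: Hilbert spaces `E_m = lvl m`, with injective (the filtration), compact and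
dense inclusions `E_{m+1} ↪ E_m`.  The underlying Hilbert space is `E_0 = lvl 0`. -/
structure ScHilbertSpace where
  lvl : ℕ → Type
  [instNormed : ∀ m, NormedAddCommGroup (lvl m)]
  [instInner : ∀ m, InnerProductSpace ℝ (lvl m)]
  [instComplete : ∀ m, CompleteSpace (lvl m)]
  incl : ∀ m, lvl (m + 1) →L[ℝ] lvl m
  incl_injective : ∀ m, Function.Injective (incl m)
  incl_compact : ∀ m, IsCompactOperator (incl m)
  incl_dense : ∀ m, DenseRange (incl m)

namespace ScHilbertSpace

attribute [instance] instNormed instInner instComplete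

/-- The inclusion `E_m ↪ E_0`. -/
def toBase (E : ScHilbertSpace) : (m : ℕ) → E.lvl m →L[ℝ] E.lvl 0
  | 0 => ContinuousLinearMap.id ℝ _
  | m + 1 => (toBase E m).comp (E.incl m)

/-- A finite-dimensional Hilbert space with the constant filtration. -/
def const (V : Type) [NormedAddCommGroup V] [InnerProductSpace ℝ V] [FiniteDimensional ℝ V] :
    ScHilbertSpace where
  lvl _ := V
  instComplete _ := FiniteDimensional.complete ℝ V
  incl _ := ContinuousLinearMap.id ℝ V
  incl_injective _ := Function.injective_id
  incl_compact _ := by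
    have := FiniteDimensional.proper ℝ V
    exact isCompactOperator_id
  incl_dense _ := Function.surjective_id.denseRange

/-- The shifted scale `E^1`, with `(E^1)_m = E_{m+1}`. -/
def up (E : ScHilbertSpace) : ScHilbertSpace where
  lvl m := E.lvl (m + 1)
  incl m := E.incl (m + 1)
  incl_injective m := E.incl_injective (m + 1)
  incl_compact m := E.incl_compact (m + 1)
  incl_dense m := E.incl_dense (m + 1)

/-- The product of continuous linear maps, on Hilbert space direct sums. -/
noncomputable def prodMapL2 {A B C D : Type} [NormedAddCommGroup A] [InnerProductSpace ℝ A]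
    [NormedAddCommGroup B] [InnerProductSpace ℝ B] [NormedAddCommGroup C] [InnerProductSpace ℝ C]
    [NormedAddCommGroup D] [InnerProductSpace ℝ D] (f : A →L[ℝ] C) (g : B →L[ℝ] D) :
    WithLp 2 (A × B) →L[ℝ] WithLp 2 (C × D) :=
  ((WithLp.prodContinuousLinearEquiv 2 ℝ C D).symm : (C × D) →L[ℝ] WithLp 2 (C × D)).comp
    ((f.prodMap g).comp
      (WithLp.prodContinuousLinearEquiv 2 ℝ A B : WithLp 2 (A × B) →L[ℝ] (A × B)))

/-- The product (= direct sum) of sc-Hilbert spaces: `(E × F)_m = E_m ⊕ F_m`. -/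
noncomputable def prod (E F : ScHilbertSpace) : ScHilbertSpace where
  lvl m := WithLp 2 (E.lvl m × F.lvl m)
  incl m := prodMapL2 (E.incl m) (F.incl m)
  incl_injective m := by
    have h : Function.Injective (Prod.map (E.incl m) (F.incl m)) :=
      (E.incl_injective m).prodMap (F.incl_injective m)
    exact (WithLp.prodContinuousLinearEquiv 2 ℝ (E.lvl m) (F.lvl m)).symm.injective.comp
      (h.comp (WithLp.prodContinuousLinearEquiv 2 ℝ (E.lvl (m+1)) (F.lvl (m+1))).injective)
  incl_compact m := by
    have h1 : IsCompactOperator ((E.incl m).prodMap (F.incl m)) := by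
      have e : ⇑((E.incl m).prodMap (F.incl m)) =
          (⇑((ContinuousLinearMap.inl ℝ (E.lvl m) (F.lvl m))) ∘ ((E.incl m) ∘
            (ContinuousLinearMap.fst ℝ (E.lvl (m+1)) (F.lvl (m+1))))) +
          (⇑((ContinuousLinearMap.inr ℝ (E.lvl m) (F.lvl m))) ∘ ((F.incl m) ∘
            (ContinuousLinearMap.snd ℝ (E.lvl (m+1)) (F.lvl (m+1))))) := by
        ext x <;> simp
      rw [e]
      exact (((E.incl_compact m).comp_clm _).clm_comp _).add
        (((F.incl_compact m).comp_clm _).clm_comp _)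
    exact (h1.comp_clm (WithLp.prodContinuousLinearEquiv 2 ℝ (E.lvl (m+1)) (F.lvl (m+1)) :
      WithLp 2 (E.lvl (m+1) × F.lvl (m+1)) →L[ℝ] (E.lvl (m+1) × F.lvl (m+1)))).clm_comp
      ((WithLp.prodContinuousLinearEquiv 2 ℝ (E.lvl m) (F.lvl m)).symm :
        (E.lvl m × F.lvl m) →L[ℝ] WithLp 2 (E.lvl m × F.lvl m))
  incl_dense m := by
    have h : DenseRange (Prod.map (E.incl m) (F.incl m)) :=
      (E.incl_dense m).prodMap (F.incl_dense m)
    have h2 := h.comp (WithLp.prodContinuousLinearEquiv 2 ℝ (E.lvl (m+1)) (F.lvl (m+1))).surjective.denseRange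
      ((E.incl m).prodMap (F.incl m)).continuous
    exact (WithLp.prodContinuousLinearEquiv 2 ℝ (E.lvl m) (F.lvl m)).symm.surjective.denseRange.comp h2
      (ContinuousLinearEquiv.continuous _)

/-- The tangent scale `TE = E^1 ⊕ E`. -/
noncomputable def tangent (E : ScHilbertSpace) : ScHilbertSpace := E.up.prod E

/-- The point `(x, y)` of `(E × F)_m`. -/
noncomputable def pair (E F : ScHilbertSpace) (m : ℕ) (x : E.lvl m) (y : F.lvl m) : (E.prod F).lvl m :=
  WithLp.toLp 2 (x, y)

/-- First component of a point of `(E × F)_m`. -/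
def proj₁ (E F : ScHilbertSpace) (m : ℕ) (z : (E.prod F).lvl m) : E.lvl m := WithLp.fst z

/-- Second component of a point of `(E × F)_m`. -/
def proj₂ (E F : ScHilbertSpace) (m : ℕ) (z : (E.prod F).lvl m) : F.lvl m := WithLp.snd z

/-- `f` is sc-continuous: for every `m` it maps `E_m` to `F_m`, and `f : E_m → F_m` is
continuous. -/
def IsScContinuous {E F : ScHilbertSpace} (f : E.lvl 0 → F.lvl 0) : Prop :=
  ∀ m, ∃ g : E.lvl m → F.lvl m, Continuous g ∧ ∀ x, F.toBase m (g x) = f (E.toBase m x)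

/-- The bounded operator `D : E_0 → F_0` is the sc-differential of `f` at the point `x ∈ E_1`:
`‖f (x + h) - f x - D h‖_{F_0} / ‖h‖_{E_1} → 0` as `h → 0` in `E_1`. -/
def HasScDerivAt {E F : ScHilbertSpace} (f : E.lvl 0 → F.lvl 0) (x : E.lvl 1)
    (D : E.lvl 0 →L[ℝ] F.lvl 0) : Prop :=
  (fun h : E.lvl 1 => f (E.incl 0 (x + h)) - f (E.incl 0 x) - D (E.incl 0 h))
    =o[𝓝 0] fun h : E.lvl 1 => h

/-- `g : TE → TF` is the tangent map of `f`: at every `x ∈ E_1` the sc-differential `D x` exists,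
and `g (x, h) = (f x, D x h)` for `x ∈ E_1` and `h ∈ E_0`. -/
def IsTangentMap {E F : ScHilbertSpace} (f : E.lvl 0 → F.lvl 0)
    (g : E.tangent.lvl 0 → F.tangent.lvl 0) : Prop :=
  ∃ D : E.lvl 1 → (E.lvl 0 →L[ℝ] F.lvl 0), (∀ x, HasScDerivAt f x (D x)) ∧
    ∀ (x : E.lvl 1) (h : E.lvl 0),
      F.incl 0 (proj₁ F.up F 0 (g (pair E.up E 0 x h))) = f (E.incl 0 x) ∧
      proj₂ F.up F 0 (g (pair E.up E 0 x h)) = D x h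

/-- `f` is `sc^k`: for `k = 0` it is sc-continuous, and it is `sc^{k+1}` if it is `sc^k` and it has
a tangent map, which is `sc^k`. -/
def IsSc : (k : ℕ) → {E F : ScHilbertSpace} → (E.lvl 0 → F.lvl 0) → Prop
  | 0, _, _, f => IsScContinuous f
  | k + 1, E, F, f => IsSc k f ∧
      ∃ g : E.tangent.lvl 0 → F.tangent.lvl 0, IsTangentMap f g ∧ IsSc k g

/-- `f` is sc-smooth. -/
def IsScSmooth {E F : ScHilbertSpace} (f : E.lvl 0 → F.lvl 0) : Prop := ∀ k, IsSc k f

/-- The sc-differential at a point is unique. -/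
theorem HasScDerivAt.unique {E F : ScHilbertSpace} {f : E.lvl 0 → F.lvl 0} {x : E.lvl 1}
    {D D' : E.lvl 0 →L[ℝ] F.lvl 0} (h : HasScDerivAt f x D) (h' : HasScDerivAt f x D') :
    D = D' := by
  have h1 := h'.sub h
  have h2 : (fun h : E.lvl 1 => ((D - D').comp (E.incl 0)) h) =o[𝓝 0] fun h : E.lvl 1 => h :=
    h1.congr_left fun y => by simp
  have h3 : (D - D').comp (E.incl 0) = 0 := by
    have a : HasFDerivAt ((D - D').comp (E.incl 0)) (0 : E.lvl 1 →L[ℝ] F.lvl 0) 0 := by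
      rw [hasFDerivAt_iff_isLittleO_nhds_zero]
      simpa using h2
    exact ((D - D').comp (E.incl 0)).hasFDerivAt.unique a
  ext y
  have h4 : (⇑(D - D')) = fun _ => 0 := by
    refine (E.incl_dense 0).equalizer (D - D').continuous continuous_const ?_
    funext z
    exact congrArg (fun L : E.lvl 1 →L[ℝ] F.lvl 0 => L z) h3
  have := congrFun h4 y
  simpa [sub_eq_zero] using this

/-- `S : B → B × F` is a section of the trivial bundle `B × F → B`. -/
def IsSection {B F : ScHilbertSpace} (S : B.lvl 0 → (B.prod F).lvl 0) : Prop :=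
  ∀ p, proj₁ B F 0 (S p) = p

/-- `D` is the vertical sc-differential, at the point `p ∈ B_1`, of the section `S` of the trivial
bundle `B × F → B`, i.e. the sc-differential of its principal part `B → F`. -/
def HasVerticalScDerivAt {B F : ScHilbertSpace} (S : B.lvl 0 → (B.prod F).lvl 0) (p : B.lvl 1)
    (D : B.lvl 0 →L[ℝ] F.lvl 0) : Prop :=
  HasScDerivAt (fun q => proj₂ B F 0 (S q)) p D

end ScHilbertSpace
namespace CircleSobolev

open AddCircle ScHilbertSpace

/-- `ℝⁿ`. -/
abbrev Vec (n : ℕ) : Type := EuclideanSpace ℝ (Fin n)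

/-- `L²(S¹, ℝⁿ)`, for `S¹ = ℝ/ℤ` with its Lebesgue measure (the Haar measure of total mass `1`). -/
abbrev L2 (n : ℕ) : Type := Lp (Vec n) 2 (haarAddCircle : Measure UnitAddCircle)

/-- `y` is the weak derivative of `x`: `∫ φ' x = - ∫ φ y` for every smooth `φ : S¹ → ℝ`
(here `ψ` is `φ'`). -/
def IsWeakDeriv {n : ℕ} (x y : L2 n) : Prop :=
  ∀ φ ψ : UnitAddCircle → ℝ, ContDiff ℝ ∞ (fun t : ℝ => φ t) →
    (∀ t : ℝ, HasDerivAt (fun s : ℝ => φ s) (ψ t) t) →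
    ∫ t, ψ t • x t ∂haarAddCircle = - ∫ t, φ t • y t ∂haarAddCircle

theorem continuous_of_lift {E : Type*} [TopologicalSpace E] {φ : UnitAddCircle → E}
    (h : Continuous fun t : ℝ => φ t) : Continuous φ :=
  QuotientAddGroup.isOpenQuotientMap_mk.isQuotientMap.continuous_iff.2 h

theorem continuous_of_test {φ ψ : UnitAddCircle → ℝ} (h : ContDiff ℝ ∞ (fun t : ℝ => φ t))
    (h' : ∀ t : ℝ, HasDerivAt (fun s : ℝ => φ s) (ψ t) t) : Continuous φ ∧ Continuous ψ := by
  refine ⟨continuous_of_lift h.continuous, continuous_of_lift ?_⟩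
  have e : (fun t : ℝ => ψ t) = deriv (fun s : ℝ => φ s) := by
    funext t; exact (h' t).deriv.symm
  rw [e]
  exact h.continuous_deriv (by simp)

theorem bdd_smul_aux {α E : Type*} [MeasurableSpace α] {μ : Measure α} [NormedAddCommGroup E]
    [NormedSpace ℝ E] {φ : α → ℝ} {f : α → E} (hf : Integrable f μ) (C : ℝ)
    (hm : AEStronglyMeasurable φ μ) (hb : ∀ᵐ t ∂μ, ‖φ t‖ ≤ C) :
    Integrable (fun t => φ t • f t) μ := hf.bdd_smul C hm hb

theorem integrable_L2 {n : ℕ} (x : L2 n) : Integrable (fun t => x t) haarAddCircle := by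
  have h := Lp.memLp x
  exact h.integrable one_le_two

theorem integrable_smul {n : ℕ} {φ : UnitAddCircle → ℝ} (h : Continuous φ) (x : L2 n) :
    Integrable (fun t => φ t • x t) haarAddCircle := by
  obtain ⟨C, hC⟩ := isCompact_univ.exists_bound_of_continuousOn h.continuousOn
  have hm : AEStronglyMeasurable φ (haarAddCircle : Measure UnitAddCircle) :=
    h.aestronglyMeasurable
  have hb : ∀ᵐ t ∂(haarAddCircle : Measure UnitAddCircle), ‖φ t‖ ≤ C :=
    .of_forall fun t => hC t trivial
  have hx := integrable_L2 x
  exact bdd_smul_aux hx C hm hb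

theorem exists_testInt {n : ℕ} {φ : UnitAddCircle → ℝ} (h : Continuous φ) :
    ∃ L : L2 n →L[ℝ] Vec n, ∀ x, L x = ∫ t, φ t • x t ∂haarAddCircle := by
  obtain ⟨C, hC⟩ := isCompact_univ.exists_bound_of_continuousOn h.continuousOn
  have hC0 : 0 ≤ C := (norm_nonneg _).trans (hC 0 trivial)
  refine ⟨LinearMap.mkContinuous
    { toFun := fun x => ∫ t, φ t • x t ∂haarAddCircle
      map_add' := fun x y => ?_
      map_smul' := fun c x => ?_ } C ?_, fun x => rfl⟩
  · rw [← integral_add (integrable_smul h x) (integrable_smul h y)]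
    refine integral_congr_ae ?_
    filter_upwards [Lp.coeFn_add x y] with t ht
    rw [ht]; simp
  · rw [RingHom.id_apply, ← integral_smul]
    refine integral_congr_ae ?_
    filter_upwards [Lp.coeFn_smul c x] with t ht
    rw [ht]; simp [smul_comm c]
  · intro x
    have h1 : Integrable (fun t => ‖x t‖) haarAddCircle := (integrable_L2 x).norm
    calc ‖∫ t, φ t • x t ∂haarAddCircle‖ ≤ ∫ t, C * ‖x t‖ ∂haarAddCircle := by
          refine norm_integral_le_of_norm_le (h1.const_mul C) (.of_forall fun t => ?_)
          rw [norm_smul]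
          exact mul_le_mul_of_nonneg_right (hC t trivial) (norm_nonneg _)
      _ = C * ∫ t, ‖x t‖ ∂haarAddCircle := integral_const_mul _ _
      _ ≤ C * ‖x‖ := by
          refine mul_le_mul_of_nonneg_left ?_ hC0
          rw [integral_norm_eq_lintegral_enorm (Lp.aestronglyMeasurable x), Lp.norm_def,
            ← eLpNorm_one_eq_lintegral_enorm]
          exact ENNReal.toReal_mono (Lp.eLpNorm_ne_top x)
            (eLpNorm_le_eLpNorm_of_exponent_le (by norm_num) (Lp.aestronglyMeasurable x))

/-- The jets `(x, ∂x, …, ∂ᵐx)` of weak derivatives in `L²`, in the Hilbert space `(L²)^{m+1}`. -/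
def jets (n m : ℕ) : Submodule ℝ (PiLp 2 fun _ : Fin (m + 1) => L2 n) where
  carrier := {x | ∀ j : Fin m, IsWeakDeriv (x j.castSucc) (x j.succ)}
  zero_mem' := fun j φ ψ h h' => by
    obtain ⟨L, hL⟩ := exists_testInt (n := n) (continuous_of_test h h').1
    obtain ⟨M, hM⟩ := exists_testInt (n := n) (continuous_of_test h h').2
    rw [← hL, ← hM]; simp
  add_mem' := fun {x y} hx hy j φ ψ h h' => by
    obtain ⟨L, hL⟩ := exists_testInt (n := n) (continuous_of_test h h').1
    obtain ⟨M, hM⟩ := exists_testInt (n := n) (continuous_of_test h h').2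
    have h1 := hx j φ ψ h h'
    have h2 := hy j φ ψ h h'
    rw [← hL, ← hM] at *
    rw [PiLp.add_apply, PiLp.add_apply, map_add, map_add, h1, h2, neg_add]
  smul_mem' := fun c x hx j φ ψ h h' => by
    obtain ⟨L, hL⟩ := exists_testInt (n := n) (continuous_of_test h h').1
    obtain ⟨M, hM⟩ := exists_testInt (n := n) (continuous_of_test h h').2
    have h1 := hx j φ ψ h h'
    rw [← hL, ← hM] at *
    rw [PiLp.smul_apply, PiLp.smul_apply, map_smul, map_smul, h1, smul_neg]

theorem isClosed_jets (n m : ℕ) : IsClosed (jets n m : Set (PiLp 2 fun _ : Fin (m + 1) => L2 n)) := by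
  have e : (jets n m : Set (PiLp 2 fun _ : Fin (m + 1) => L2 n)) =
      ⋂ (j : Fin m) (φ : UnitAddCircle → ℝ) (ψ : UnitAddCircle → ℝ)
        (_ : ContDiff ℝ ∞ (fun t : ℝ => φ t))
        (_ : ∀ t : ℝ, HasDerivAt (fun s : ℝ => φ s) (ψ t) t),
        {x | ∫ t, ψ t • x j.castSucc t ∂haarAddCircle =
          - ∫ t, φ t • x j.succ t ∂haarAddCircle} := by
    ext x; simp only [Set.mem_iInter]; rfl
  rw [e]
  refine isClosed_iInter fun j => isClosed_iInter fun φ => isClosed_iInter fun ψ =>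
    isClosed_iInter fun h => isClosed_iInter fun h' => ?_
  obtain ⟨L, hL⟩ := exists_testInt (n := n) (continuous_of_test h h').1
  obtain ⟨M, hM⟩ := exists_testInt (n := n) (continuous_of_test h h').2
  simp only [← hL, ← hM]
  exact isClosed_eq (by fun_prop) (by fun_prop)

/-- The Sobolev space `H_m = W^{m,2}(S¹, ℝⁿ)`.  An element `x` is stored together with its weak
derivatives, which it determines (`fn_injective` below), and
`‖x‖² = ‖x‖²_{L²} + ‖∂x‖²_{L²} + … + ‖∂ᵐx‖²_{L²}`. -/
abbrev Sobolev (n m : ℕ) : Type := jets n m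

instance (n m : ℕ) : CompleteSpace (Sobolev n m) := (isClosed_jets n m).completeSpace_coe

/-- The map on tuples `x ↦ (L x_{σ 0}, L x_{σ 1}, …)`. -/
noncomputable def tupleMap {n a b : ℕ} (σ : Fin a → Fin b) (L : L2 n →L[ℝ] L2 n) :
    (PiLp 2 fun _ : Fin b => L2 n) →L[ℝ] (PiLp 2 fun _ : Fin a => L2 n) :=
  ((PiLp.continuousLinearEquiv 2 ℝ fun _ : Fin a => L2 n).symm :
      (Fin a → L2 n) →L[ℝ] PiLp 2 fun _ : Fin a => L2 n).comp
    (ContinuousLinearMap.pi fun j => L.comp (PiLp.proj 2 (fun _ : Fin b => L2 n) (σ j)))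

theorem tupleMap_apply {n a b : ℕ} (σ : Fin a → Fin b) (L : L2 n →L[ℝ] L2 n)
    (x : PiLp 2 fun _ : Fin b => L2 n) (j : Fin a) : tupleMap σ L x j = L (x (σ j)) := rfl

/-- The inclusion `H_{m+1} ↪ H_m`. -/
noncomputable def incl (n m : ℕ) : Sobolev n (m + 1) →L[ℝ] Sobolev n m :=
  ((tupleMap Fin.castSucc (ContinuousLinearMap.id ℝ _)).comp (jets n (m + 1)).subtypeL).codRestrict
    (jets n m) fun x j => x.2 j.castSucc

/-- The weak derivative `∂_t : H_{m+1} → H_m`. -/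
noncomputable def wderiv (n m : ℕ) : Sobolev n (m + 1) →L[ℝ] Sobolev n m :=
  ((tupleMap Fin.succ (ContinuousLinearMap.id ℝ _)).comp (jets n (m + 1)).subtypeL).codRestrict
    (jets n m) fun x j => x.2 j.succ

/-- The `L²` function underlying an element of `H_m`. -/
noncomputable def fn {n m : ℕ} : Sobolev n m →L[ℝ] L2 n :=
  (PiLp.proj 2 (fun _ : Fin (m + 1) => L2 n) 0).comp (jets n m).subtypeL

/-- The identification `L² = H_0`. -/
noncomputable def ofL2 {n : ℕ} (x : L2 n) : Sobolev n 0 := ⟨WithLp.toLp 2 fun _ => x, fun j => j.elim0⟩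

theorem fn_ofL2 {n : ℕ} (x : L2 n) : fn (ofL2 x) = x := rfl

theorem fn_incl {n m : ℕ} (x : Sobolev n (m + 1)) : fn (incl n m x) = fn x := rfl

theorem isWeakDeriv_wderiv {n m : ℕ} (x : Sobolev n (m + 1)) :
    IsWeakDeriv (fn x) (fn (wderiv n m x)) := x.2 0

/-- The shift `x ↦ x(· - τ)` on `L²`. -/
noncomputable def shiftL2 {n : ℕ} (τ : ℝ) : L2 n →L[ℝ] L2 n :=
  (Lp.compMeasurePreservingₗᵢ ℝ (fun t : UnitAddCircle => t - (τ : UnitAddCircle))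
    (measurePreserving_sub_right haarAddCircle (τ : UnitAddCircle))).toContinuousLinearMap

theorem shiftL2_ae {n : ℕ} (τ : ℝ) (x : L2 n) :
    shiftL2 τ x =ᵐ[haarAddCircle] fun t => x (t - (τ : UnitAddCircle)) :=
  Lp.coeFn_compMeasurePreserving x (measurePreserving_sub_right haarAddCircle (τ : UnitAddCircle))

theorem integral_smul_shiftL2 {n : ℕ} (τ : ℝ) (x : L2 n) (φ : UnitAddCircle → ℝ) :
    ∫ t, φ t • shiftL2 τ x t ∂haarAddCircle =
      ∫ t, φ (t + (τ : UnitAddCircle)) • x t ∂haarAddCircle := by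
  have h1 : ∫ t, φ t • shiftL2 τ x t ∂haarAddCircle =
      ∫ t, (fun u => φ (u + (τ : UnitAddCircle)) • x u) (t - (τ : UnitAddCircle))
        ∂haarAddCircle := by
    refine integral_congr_ae ?_
    filter_upwards [shiftL2_ae τ x] with t ht
    simp [ht]
  rw [h1]
  exact integral_sub_right_eq_self (μ := haarAddCircle)
    (fun u => φ (u + (τ : UnitAddCircle)) • x u) (τ : UnitAddCircle)

theorem IsWeakDeriv.shiftL2 {n : ℕ} {x y : L2 n} (h : IsWeakDeriv x y) (τ : ℝ) :
    IsWeakDeriv (shiftL2 τ x) (shiftL2 τ y) := by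
  intro φ ψ hφ hψ
  rw [integral_smul_shiftL2, integral_smul_shiftL2]
  refine h (fun t => φ (t + (τ : UnitAddCircle))) (fun t => ψ (t + (τ : UnitAddCircle))) ?_ ?_
  · have : ContDiff ℝ ∞ (fun t : ℝ => t + τ) := by fun_prop
    simpa [Function.comp_def] using hφ.comp this
  · intro t
    simpa using (hψ (t + τ)).comp_add_const t τ

/-- The shift map `φ(τ, ·) : H_m → H_m`, `x ↦ x(· - τ)`. -/
noncomputable def shift {n m : ℕ} (τ : ℝ) : Sobolev n m →L[ℝ] Sobolev n m :=
  ((tupleMap id (shiftL2 τ)).comp (jets n m).subtypeL).codRestrict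
    (jets n m) fun x j => (x.2 j).shiftL2 τ

theorem fn_shift_ae {n m : ℕ} (τ : ℝ) (x : Sobolev n m) :
    fn (shift τ x) =ᵐ[haarAddCircle] fun t => fn x (t - (τ : UnitAddCircle)) :=
  shiftL2_ae τ (fn x)


/-- The `i`-th coordinate of an `L²` function, as a complex valued function. -/
noncomputable def coord {n : ℕ} (i : Fin n) :
    L2 n →L[ℝ] Lp ℂ 2 (haarAddCircle : Measure UnitAddCircle) :=
  (Complex.ofRealCLM.comp (EuclideanSpace.proj i : Vec n →L[ℝ] ℝ)).compLpL 2 haarAddCircle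

theorem coord_ae {n : ℕ} (i : Fin n) (x : L2 n) :
    coord i x =ᵐ[haarAddCircle] fun t => ((x t i : ℝ) : ℂ) :=
  ContinuousLinearMap.coeFn_compLpL _ x

/-- The `L²` function with `i`-th coordinate the real part of a given function, and with the other
coordinates zero. -/
noncomputable def uncoord {n : ℕ} (i : Fin n) :
    Lp ℂ 2 (haarAddCircle : Measure UnitAddCircle) →L[ℝ] L2 n :=
  ((ContinuousLinearMap.toSpanSingleton ℝ (EuclideanSpace.single i (1 : ℝ) : Vec n)).comp
    Complex.reCLM).compLpL 2 haarAddCircle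

theorem uncoord_ae {n : ℕ} (i : Fin n) (f : Lp ℂ 2 (haarAddCircle : Measure UnitAddCircle)) :
    uncoord i f =ᵐ[haarAddCircle] fun t => (f t).re • (EuclideanSpace.single i (1 : ℝ) : Vec n) :=
  ContinuousLinearMap.coeFn_compLpL _ f

theorem sum_uncoord_coord {n : ℕ} (x : L2 n) : ∑ i, uncoord i (coord i x) = x := by
  have h0 : ⇑(∑ i, uncoord i (coord i x)) =ᵐ[haarAddCircle]
      ∑ i, ⇑(uncoord i (coord i x)) := Lp.coeFn_finsetSum _ _
  refine Lp.ext ?_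
  have h1 : ∀ᵐ t ∂(haarAddCircle : Measure UnitAddCircle), ∀ i : Fin n,
      uncoord i (coord i x) t = (x t i) • (EuclideanSpace.single i (1 : ℝ) : Vec n) := by
    rw [ae_all_iff]
    intro i
    filter_upwards [uncoord_ae i (coord i x), coord_ae i x] with t h1 h2
    rw [h1, h2]; simp
  filter_upwards [h0, h1] with t h0 h1
  rw [h0, Finset.sum_apply]
  simp only [h1]
  ext j
  simp [Finset.sum_apply, Pi.single_apply]

theorem continuous_of_hasDerivAt {φ ψ : UnitAddCircle → ℂ}
    (h' : ∀ t : ℝ, HasDerivAt (fun s : ℝ => φ s) (ψ t) t) : Continuous φ :=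
  continuous_of_lift (continuous_iff_continuousAt.2 fun t => (h' t).continuousAt)

theorem integrable_mul_coord {n : ℕ} {φ : UnitAddCircle → ℝ} (h : Continuous φ) (x : L2 n)
    (i : Fin n) : Integrable (fun t => φ t * x t i) haarAddCircle := by
  have h1 := integrable_smul h x
  exact (EuclideanSpace.proj i : Vec n →L[ℝ] ℝ).integrable_comp h1

theorem integral_coord {n : ℕ} {φ : UnitAddCircle → ℝ} (h : Continuous φ) (x : L2 n)
    (i : Fin n) : (∫ t, φ t • x t ∂haarAddCircle) i = ∫ t, φ t * x t i ∂haarAddCircle := by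
  have h1 := integrable_smul h x
  exact ((EuclideanSpace.proj i : Vec n →L[ℝ] ℝ).integral_comp_comm h1).symm

theorem integral_complex_coord {n : ℕ} {φ : UnitAddCircle → ℂ} (h : Continuous φ) (x : L2 n)
    (i : Fin n) : ∫ t, φ t * coord i x t ∂haarAddCircle =
      ((∫ t, (φ t).re • x t ∂haarAddCircle) i : ℝ) +
      ((∫ t, (φ t).im • x t ∂haarAddCircle) i : ℝ) * Complex.I := by
  have hr : Continuous fun t => (φ t).re := Complex.continuous_re.comp h
  have hi : Continuous fun t => (φ t).im := Complex.continuous_im.comp h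
  rw [integral_coord hr, integral_coord hi, ← integral_complex_ofReal, ← integral_complex_ofReal,
    ← integral_mul_const, ← integral_add]
  · refine integral_congr_ae ?_
    filter_upwards [coord_ae i x] with t ht
    rw [ht]
    apply Complex.ext <;> simp
  · exact (integrable_mul_coord hr x i).ofReal
  · exact ((integrable_mul_coord hi x i).ofReal).mul_const _

theorem IsWeakDeriv.complex {n : ℕ} {x y : L2 n} (hxy : IsWeakDeriv x y) (i : Fin n)
    {φ ψ : UnitAddCircle → ℂ} (h : ContDiff ℝ ∞ (fun t : ℝ => φ t))
    (h' : ∀ t : ℝ, HasDerivAt (fun s : ℝ => φ s) (ψ t) t) :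
    ∫ t, ψ t * coord i x t ∂haarAddCircle = - ∫ t, φ t * coord i y t ∂haarAddCircle := by
  have hψ : Continuous ψ := by
    refine continuous_of_lift ?_
    have e : (fun t : ℝ => ψ t) = deriv (fun s : ℝ => φ s) := by
      funext t; exact (h' t).deriv.symm
    rw [e]
    exact h.continuous_deriv (by simp)
  rw [integral_complex_coord hψ, integral_complex_coord (continuous_of_hasDerivAt h'),
    hxy (fun t => (φ t).re) (fun t => (ψ t).re) (Complex.reCLM.contDiff.comp h)
      (fun t => Complex.reCLM.hasFDerivAt.comp_hasDerivAt t (h' t)),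
    hxy (fun t => (φ t).im) (fun t => (ψ t).im) (Complex.imCLM.contDiff.comp h)
      (fun t => Complex.imCLM.hasFDerivAt.comp_hasDerivAt t (h' t))]
  simp only [PiLp.neg_apply, Complex.ofReal_neg]
  ring

theorem contDiff_fourier (k : ℤ) : ContDiff ℝ ∞ (fun t : ℝ => fourier k (t : UnitAddCircle)) := by
  simp only [fourier_coe_apply]
  have h : ContDiff ℝ ∞ (fun t : ℝ => (t : ℂ)) := Complex.ofRealCLM.contDiff
  fun_prop

theorem fourierCoeff_weakDeriv {n : ℕ} {x y : L2 n} (hxy : IsWeakDeriv x y) (i : Fin n) (k : ℤ) :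
    fourierCoeff (coord i y) k = 2 * Real.pi * Complex.I * k * fourierCoeff (coord i x) k := by
  have h := hxy.complex i (φ := fun t => fourier (-k) t)
    (ψ := fun t => -2 * Real.pi * Complex.I * k * fourier (-k) t) (contDiff_fourier (-k))
    (fun t => by simpa using hasDerivAt_fourier_neg (1 : ℝ) k t)
  simp only [mul_assoc (-2 * Real.pi * Complex.I * (k : ℂ))] at h
  rw [integral_const_mul] at h
  simp only [fourierCoeff, smul_eq_mul]
  linear_combination h

theorem norm_le_of_fourierCoeff {f g : Lp ℂ 2 (haarAddCircle : Measure UnitAddCircle)} {c : ℝ}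
    (hc : 0 ≤ c) (h : ∀ k, ‖fourierCoeff f k‖ ≤ c * ‖fourierCoeff g k‖) : ‖f‖ ≤ c * ‖g‖ := by
  have e : ∀ f : Lp ℂ 2 (haarAddCircle : Measure UnitAddCircle),
      HasSum (fun k => ‖fourierCoeff f k‖ ^ 2) (‖f‖ ^ 2) := by
    intro f
    simp_rw [← fourierBasis_repr]
    have H₁ : HasSum (fun i => ‖fourierBasis.repr f i‖ ^ 2) (‖fourierBasis.repr f‖ ^ 2) := by
      apply_mod_cast lp.hasSum_norm ?_ (fourierBasis.repr f)
      simp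
    simpa using H₁
  refine abs_le_of_sq_le_sq' ?_ (by positivity) |>.2
  rw [mul_pow]
  refine hasSum_le (fun k => ?_) (e f) ((e g).mul_left (c ^ 2))
  rw [← mul_pow]
  exact pow_le_pow_left₀ (norm_nonneg _) (h k) 2

theorem eq_zero_of_fourierCoeff {n : ℕ} {x : L2 n}
    (h : ∀ i k, fourierCoeff (coord i x) k = 0) : x = 0 := by
  rw [← sum_uncoord_coord x]
  refine Finset.sum_eq_zero fun i _ => ?_
  have : ‖coord i x‖ ≤ 0 * ‖coord i x‖ := norm_le_of_fourierCoeff le_rfl fun k => by simp [h]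
  rw [zero_mul, norm_le_zero_iff] at this
  rw [this, map_zero]

/-- Weak derivatives are unique. -/
theorem IsWeakDeriv.unique {n : ℕ} {x y z : L2 n} (hy : IsWeakDeriv x y) (hz : IsWeakDeriv x z) :
    y = z := by
  rw [← sub_eq_zero]
  refine eq_zero_of_fourierCoeff fun i k => ?_
  have e : fourierCoeff (coord i (y - z)) k =
      fourierCoeff (coord i y) k - fourierCoeff (coord i z) k := by
    simp only [← fourierBasis_repr, map_sub]
    rfl
  rw [e, fourierCoeff_weakDeriv hy, fourierCoeff_weakDeriv hz, sub_self]

theorem jets_ext {n m : ℕ} {x y : Sobolev n m} (h : x.1 0 = y.1 0) : x = y := by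
  apply Subtype.ext
  refine PiLp.ext fun j => ?_
  induction j using Fin.induction with
  | zero => exact h
  | succ j ih =>
    have h1 := x.2 j
    rw [ih] at h1
    exact h1.unique (y.2 j)

/-- An element of `H_m` is determined by the underlying `L²` function. -/
theorem fn_injective {n m : ℕ} : Function.Injective (fn : Sobolev n m → L2 n) :=
  fun _ _ h => jets_ext h

theorem incl_injective (n m : ℕ) : Function.Injective (incl n m) :=
  fun x y h => fn_injective (by rw [← fn_incl x, h, fn_incl])

/-- Partial sums of the Fourier series. -/
noncomputable def partialSum (N : ℕ) : Lp ℂ 2 (haarAddCircle : Measure UnitAddCircle) →L[ℂ]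
    Lp ℂ 2 (haarAddCircle : Measure UnitAddCircle) :=
  ∑ k ∈ Finset.Icc (-(N : ℤ)) N,
    (innerSL ℂ (fourierLp 2 k : Lp ℂ 2 (haarAddCircle : Measure UnitAddCircle))).smulRight
      (fourierLp 2 k)

theorem fourierCoeff_eq_inner (f : Lp ℂ 2 (haarAddCircle : Measure UnitAddCircle)) (k : ℤ) :
    fourierCoeff f k = inner ℂ (fourierLp 2 k) f := by
  rw [← fourierBasis_repr, HilbertBasis.repr_apply_apply, coe_fourierBasis]

theorem fourierCoeff_sub_partialSum (N : ℕ) (f : Lp ℂ 2 (haarAddCircle : Measure UnitAddCircle))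
    (k : ℤ) : fourierCoeff (f - partialSum N f : Lp ℂ 2 (haarAddCircle : Measure UnitAddCircle)) k =
      if k ∈ Finset.Icc (-(N : ℤ)) N then 0 else fourierCoeff f k := by
  have ho := orthonormal_iff_ite.1 (orthonormal_fourier (T := (1 : ℝ)))
  have e : partialSum N f = ∑ l ∈ Finset.Icc (-(N : ℤ)) N,
      (inner ℂ (fourierLp 2 l) f : ℂ) •
        (fourierLp 2 l : Lp ℂ 2 (haarAddCircle : Measure UnitAddCircle)) := by
    simp [partialSum]
  rw [fourierCoeff_eq_inner, fourierCoeff_eq_inner, inner_sub_right, e, inner_sum]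
  simp only [inner_smul_right, ho, mul_ite, mul_one, mul_zero, Finset.sum_ite_eq]
  split_ifs <;> simp

theorem isCompactOperator_partialSum (N : ℕ) : IsCompactOperator (partialSum N) := by
  have : partialSum N ∈ compactOperator (RingHom.id ℂ)
      (Lp ℂ 2 (haarAddCircle : Measure UnitAddCircle))
      (Lp ℂ 2 (haarAddCircle : Measure UnitAddCircle)) := by
    refine Submodule.sum_mem _ fun k _ => ?_
    have h1 : IsCompactOperator
        (innerSL ℂ (fourierLp 2 k : Lp ℂ 2 (haarAddCircle : Measure UnitAddCircle))) :=
      isCompactOperator_of_locallyCompactSpace_dom _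
    exact h1.clm_comp (ContinuousLinearMap.toSpanSingleton ℂ
      (fourierLp 2 k : Lp ℂ 2 (haarAddCircle : Measure UnitAddCircle)))
  exact this

theorem isCompactOperator_coord {n m : ℕ} (j : Fin (m + 1)) (i : Fin n) :
    IsCompactOperator (fun x : Sobolev n (m + 1) => coord i (x.1 j.castSucc)) := by
  let K : Fin (m + 2) → (Sobolev n (m + 1) →L[ℝ] Lp ℂ 2 (haarAddCircle : Measure UnitAddCircle)) :=
    fun l => (coord i).comp ((PiLp.proj 2 (fun _ : Fin (m + 2) => L2 n) l).comp
      (jets n (m + 1)).subtypeL)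
  change IsCompactOperator (K j.castSucc)
  refine isCompactOperator_of_tendsto (l := Filter.atTop)
    (F := fun N : ℕ => ((partialSum N).restrictScalars ℝ).comp (K j.castSucc)) ?_ ?_
  · refine (tendsto_iff_norm_sub_tendsto_zero
      (E := Sobolev n (m + 1) →L[ℝ] Lp ℂ 2 (haarAddCircle : Measure UnitAddCircle))).2 ?_
    have hlim : Filter.Tendsto (fun N : ℕ => 1 / ((N : ℝ) + 1) * ‖K j.succ‖) Filter.atTop
        (𝓝 0) := by
      simpa using (tendsto_one_div_add_atTop_nhds_zero_nat (𝕜 := ℝ)).mul_const ‖K j.succ‖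
    refine squeeze_zero (fun N => norm_nonneg
      (((partialSum N).restrictScalars ℝ).comp (K j.castSucc) - K j.castSucc)) (fun N => ?_) hlim
    refine ContinuousLinearMap.opNorm_le_bound _ (by positivity) fun x => ?_
    rw [mul_assoc]
    refine le_trans ?_ (mul_le_mul_of_nonneg_left ((K j.succ).le_opNorm x) (by positivity))
    rw [sub_apply, ← norm_neg, neg_sub]
    refine norm_le_of_fourierCoeff (by positivity) fun k => ?_
    refine (congrArg norm (fourierCoeff_sub_partialSum N (K j.castSucc x) k)).trans_le ?_
    split_ifs with hk
    · rw [norm_zero]; positivity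
    · have hd : fourierCoeff (K j.succ x) k =
          2 * Real.pi * Complex.I * k * fourierCoeff (K j.castSucc x) k :=
        fourierCoeff_weakDeriv (x.2 j) i k
      have hk' : (N : ℝ) + 1 ≤ |(k : ℝ)| := by
        have : (N : ℤ) + 1 ≤ |k| := by
          by_contra hlt
          refine hk (Finset.mem_Icc.2 (abs_le.1 ?_))
          omega
        exact_mod_cast this
      have hn : ‖(2 * Real.pi * Complex.I * k : ℂ)‖ = 2 * Real.pi * |(k : ℝ)| := by
        simp [abs_of_pos Real.pi_pos]
      rw [hd, norm_mul, hn, one_div, inv_mul_eq_div, le_div_iff₀ (by positivity), mul_comm]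
      refine mul_le_mul_of_nonneg_right ?_ (norm_nonneg _)
      nlinarith [Real.pi_gt_three, abs_nonneg (k : ℝ)]
  · exact .of_forall fun N => IsCompactOperator.comp_clm
      (f := ⇑((partialSum N).restrictScalars ℝ)) (isCompactOperator_partialSum N) (K j.castSucc)

/-- The inclusions are compact. -/
theorem incl_compact (n m : ℕ) : IsCompactOperator (incl n m) := by
  refine IsCompactOperator.codRestrict (V := jets n m)
    (f := (tupleMap Fin.castSucc (ContinuousLinearMap.id ℝ _)).comp (jets n (m + 1)).subtypeL)
    ?_ _ (isClosed_jets n m)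
  have e : ⇑((tupleMap Fin.castSucc (ContinuousLinearMap.id ℝ (L2 n))).comp
      (jets n (m + 1)).subtypeL) = ⇑(∑ j : Fin (m + 1), ∑ i : Fin n,
        ((((PiLp.continuousLinearEquiv 2 ℝ fun _ : Fin (m + 1) => L2 n).symm :
            (Fin (m + 1) → L2 n) →L[ℝ] PiLp 2 fun _ : Fin (m + 1) => L2 n).comp
          ((ContinuousLinearMap.single ℝ (fun _ : Fin (m + 1) => L2 n) j).comp (uncoord i))).comp
        ((coord i).comp ((PiLp.proj 2 (fun _ : Fin (m + 2) => L2 n) j.castSucc).comp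
          (jets n (m + 1)).subtypeL)))) := by
    funext x
    refine PiLp.ext fun l => ?_
    rw [sum_apply]
    simp only [sum_apply]
    change x.1 l.castSucc = PiLp.proj (𝕜 := ℝ) 2 (fun _ : Fin (m + 1) => L2 n) l _
    rw [map_sum]
    have : ∀ j : Fin (m + 1), PiLp.proj (𝕜 := ℝ) 2 (fun _ : Fin (m + 1) => L2 n) l
        (∑ i : Fin n, ((((PiLp.continuousLinearEquiv 2 ℝ fun _ : Fin (m + 1) => L2 n).symm :
            (Fin (m + 1) → L2 n) →L[ℝ] PiLp 2 fun _ : Fin (m + 1) => L2 n).comp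
          ((ContinuousLinearMap.single ℝ (fun _ : Fin (m + 1) => L2 n) j).comp (uncoord i))).comp
        ((coord i).comp ((PiLp.proj 2 (fun _ : Fin (m + 2) => L2 n) j.castSucc).comp
          (jets n (m + 1)).subtypeL))) x) = if j = l then x.1 j.castSucc else 0 := by
      intro j
      rw [map_sum]
      have e : ∀ i : Fin n, PiLp.proj (𝕜 := ℝ) 2 (fun _ : Fin (m + 1) => L2 n) l
        (((((PiLp.continuousLinearEquiv 2 ℝ fun _ : Fin (m + 1) => L2 n).symm :
            (Fin (m + 1) → L2 n) →L[ℝ] PiLp 2 fun _ : Fin (m + 1) => L2 n).comp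
          ((ContinuousLinearMap.single ℝ (fun _ : Fin (m + 1) => L2 n) j).comp (uncoord i))).comp
        ((coord i).comp ((PiLp.proj 2 (fun _ : Fin (m + 2) => L2 n) j.castSucc).comp
          (jets n (m + 1)).subtypeL))) x) =
          (Pi.single j (uncoord i (coord i (x.1 j.castSucc))) : Fin (m + 1) → L2 n) l :=
        fun i => rfl
      simp only [e]
      by_cases hjl : j = l
      · subst hjl
        simp [sum_uncoord_coord]
      · simp [hjl, Ne.symm hjl]
    refine Eq.trans ?_ (Finset.sum_congr rfl fun j _ => this j).symm
    rw [Finset.sum_ite_eq', if_pos (Finset.mem_univ l)]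
  rw [e]
  have : (∑ j : Fin (m + 1), ∑ i : Fin n,
        ((((PiLp.continuousLinearEquiv 2 ℝ fun _ : Fin (m + 1) => L2 n).symm :
            (Fin (m + 1) → L2 n) →L[ℝ] PiLp 2 fun _ : Fin (m + 1) => L2 n).comp
          ((ContinuousLinearMap.single ℝ (fun _ : Fin (m + 1) => L2 n) j).comp (uncoord i))).comp
        ((coord i).comp ((PiLp.proj 2 (fun _ : Fin (m + 2) => L2 n) j.castSucc).comp
          (jets n (m + 1)).subtypeL)))) ∈ compactOperator (RingHom.id ℝ)
      (Sobolev n (m + 1)) (PiLp 2 fun _ : Fin (m + 1) => L2 n) := by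
    refine Submodule.sum_mem _ fun j _ => Submodule.sum_mem _ fun i _ => ?_
    exact (isCompactOperator_coord j i).clm_comp
      (((PiLp.continuousLinearEquiv 2 ℝ fun _ : Fin (m + 1) => L2 n).symm :
            (Fin (m + 1) → L2 n) →L[ℝ] PiLp 2 fun _ : Fin (m + 1) => L2 n).comp
          ((ContinuousLinearMap.single ℝ (fun _ : Fin (m + 1) => L2 n) j).comp (uncoord i)))
  exact this
/-- The real part of a trigonometric monomial, in the `i`-th coordinate. -/
noncomputable def trig {n : ℕ} (k : ℤ) (i : Fin n) (c : ℂ) : L2 n :=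
  uncoord i (c • fourierLp 2 k)

theorem trig_ae {n : ℕ} (k : ℤ) (i : Fin n) (c : ℂ) : trig k i c =ᵐ[haarAddCircle]
    fun t => (c * fourier k t).re • (EuclideanSpace.single i (1 : ℝ) : Vec n) := by
  filter_upwards [uncoord_ae i (c • fourierLp 2 k),
    Lp.coeFn_smul c (fourierLp 2 k : Lp ℂ 2 (haarAddCircle : Measure UnitAddCircle)),
    coeFn_fourierLp (T := (1 : ℝ)) 2 k] with t h1 h2 h3
  rw [trig, h1, h2, Pi.smul_apply, h3, smul_eq_mul]

theorem isWeakDeriv_of_hasDerivAt {n : ℕ} {x y : L2 n} {u v : UnitAddCircle → ℝ} (w : Vec n)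
    (hx : x =ᵐ[haarAddCircle] fun t => u t • w) (hy : y =ᵐ[haarAddCircle] fun t => v t • w)
    (hv : Continuous v) (h : ∀ t : ℝ, HasDerivAt (fun s : ℝ => u s) (v t) t) :
    IsWeakDeriv x y := by
  intro φ ψ hφ hψ
  obtain ⟨cφ, cψ⟩ := continuous_of_test hφ hψ
  have cu : Continuous u :=
    continuous_of_lift (continuous_iff_continuousAt.2 fun t => (h t).continuousAt)
  have e1 : ∫ t, ψ t • x t ∂haarAddCircle = (∫ t, ψ t * u t ∂haarAddCircle) • w := by
    rw [← integral_smul_const]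
    refine integral_congr_ae ?_
    filter_upwards [hx] with t ht
    rw [ht, smul_smul]
  have e2 : ∫ t, φ t • y t ∂haarAddCircle = (∫ t, φ t * v t ∂haarAddCircle) • w := by
    rw [← integral_smul_const]
    refine integral_congr_ae ?_
    filter_upwards [hy] with t ht
    rw [ht, smul_smul]
  have e3 : ∀ f : UnitAddCircle → ℝ,
      ∫ t, f t ∂(haarAddCircle : Measure UnitAddCircle) = ∫ t in (0 : ℝ)..1, f t := by
    intro f
    rw [integral_haarAddCircle, inv_one, one_smul, ← AddCircle.intervalIntegral_preimage 1 0 f,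
      zero_add]
  have c0 : Continuous fun t : ℝ => (t : UnitAddCircle) := AddCircle.continuous_mk' 1
  have i1 : IntervalIntegrable (fun t : ℝ => ψ t) volume 0 1 :=
    (cψ.comp c0).intervalIntegrable _ _
  have i2 : IntervalIntegrable (fun t : ℝ => v t) volume 0 1 :=
    (hv.comp c0).intervalIntegrable _ _
  have e4 := intervalIntegral.integral_mul_deriv_eq_deriv_mul (a := (0 : ℝ)) (b := 1)
    (u := fun t : ℝ => φ t) (v := fun t : ℝ => u t)
    (u' := fun t : ℝ => ψ t) (v' := fun t : ℝ => v t)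
    (fun t _ => hψ t) (fun t _ => h t) i1 i2
  have e5 : ((1 : ℝ) : UnitAddCircle) = ((0 : ℝ) : UnitAddCircle) := by
    rw [AddCircle.coe_period]; rfl
  rw [e1, e2, e3, e3, e4, e5, sub_self, zero_sub, neg_smul, neg_neg]

theorem isWeakDeriv_trig {n : ℕ} (k : ℤ) (i : Fin n) (c : ℂ) :
    IsWeakDeriv (trig k i c) (trig k i (2 * Real.pi * Complex.I * k * c)) := by
  refine isWeakDeriv_of_hasDerivAt _ (trig_ae k i c) (trig_ae k i _) ?_ fun t => ?_
  · exact Complex.continuous_re.comp (continuous_const.mul (fourier k).continuous)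
  · have h1 := (hasDerivAt_fourier (1 : ℝ) k t).const_mul c
    have h2 := Complex.reCLM.hasFDerivAt.comp_hasDerivAt t h1
    refine h2.congr_deriv ?_
    simp only [Complex.reCLM_apply, Complex.ofReal_one, div_one]
    congr 1
    ring

/-- The jet of a trigonometric monomial. -/
noncomputable def trigJet {n : ℕ} (m : ℕ) (k : ℤ) (i : Fin n) (c : ℂ) : Sobolev n m :=
  ⟨WithLp.toLp 2 fun j => trig k i ((2 * Real.pi * Complex.I * k) ^ (j : ℕ) * c), fun j => by
    have h := isWeakDeriv_trig k i ((2 * Real.pi * Complex.I * k) ^ (j : ℕ) * c)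
    rw [← mul_assoc, ← pow_succ'] at h
    exact h⟩

theorem inner_trig {n : ℕ} (k : ℤ) (i : Fin n) (c : ℂ) (y : L2 n) :
    inner ℝ (trig k i c) y = (c * fourierCoeff (coord i y) (-k)).re := by
  have hc : Continuous fun t : UnitAddCircle => c * fourier k t :=
    continuous_const.mul (fourier k).continuous
  have e1 : c * fourierCoeff (coord i y) (-k) =
      ∫ t, (c * fourier k t) * coord i y t ∂haarAddCircle := by
    simp only [fourierCoeff, neg_neg, smul_eq_mul, mul_assoc]
    rw [integral_const_mul]
  have e2 := integral_coord (φ := fun t => (c * fourier k t).re)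
    (Complex.continuous_re.comp hc) y i
  rw [e1, integral_complex_coord hc, e2, L2.inner_def]
  simp only [Complex.add_re, Complex.ofReal_re, Complex.mul_re, Complex.I_re, mul_zero,
    Complex.ofReal_im, Complex.I_im, mul_one, sub_self, add_zero]
  refine integral_congr_ae ?_
  filter_upwards [trig_ae k i c] with t ht
  rw [ht, inner_smul_left, EuclideanSpace.inner_single_left]
  simp

theorem fourierCoeff_jet {n m : ℕ} (y : Sobolev n m) (i : Fin n) (k : ℤ) (j : Fin (m + 1)) :
    fourierCoeff (coord i (y.1 j)) k =
      (2 * Real.pi * Complex.I * k) ^ (j : ℕ) * fourierCoeff (coord i (y.1 0)) k := by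
  induction j using Fin.induction with
  | zero => simp
  | succ j ih =>
    rw [fourierCoeff_weakDeriv (y.2 j), ih, Fin.val_succ, pow_succ', Fin.val_castSucc]
    ring

/-- The inclusions are dense. -/
theorem incl_dense (n m : ℕ) : DenseRange (incl n m) := by
  have key : (LinearMap.range (incl n m).toLinearMap).topologicalClosure = ⊤ := by
    rw [Submodule.topologicalClosure_eq_top_iff, Submodule.eq_bot_iff]
    intro y hy
    rw [Submodule.mem_orthogonal] at hy
    have h0 : y.1 0 = 0 := by
      refine eq_zero_of_fourierCoeff fun i k => ?_
      set a := fourierCoeff (coord i (y.1 0)) k with ha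
      set c : ℂ := (starRingEnd ℂ) a with hc
      have h1 : inner ℝ (trigJet m (-k) i c) y = 0 :=
        hy _ ⟨trigJet (m + 1) (-k) i c, rfl⟩
      have h2 : inner ℝ (trigJet m (-k) i c) y = ∑ j : Fin (m + 1),
          (2 * Real.pi * k) ^ (2 * (j : ℕ)) * Complex.normSq a := by
        rw [Submodule.coe_inner, PiLp.inner_apply]
        refine Finset.sum_congr rfl fun j _ => ?_
        change inner ℝ (trig (-k) i ((2 * Real.pi * Complex.I * (-k : ℤ)) ^ (j : ℕ) * c)) (y.1 j) = _
        rw [inner_trig, neg_neg, fourierCoeff_jet, ← ha]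
        have e : (2 * Real.pi * Complex.I * (-k : ℤ)) ^ (j : ℕ) * c *
            ((2 * Real.pi * Complex.I * k) ^ (j : ℕ) * a) =
            (((2 * Real.pi * k) ^ (2 * (j : ℕ)) * Complex.normSq a : ℝ) : ℂ) := by
          have e1 : c * a = (Complex.normSq a : ℂ) := (Complex.normSq_eq_conj_mul_self).symm
          have e2 : (2 * Real.pi * Complex.I * (-k : ℤ)) * (2 * Real.pi * Complex.I * k) =
              ((2 * Real.pi * k : ℂ)) ^ 2 := by
            push_cast
            linear_combination (-4 * (Real.pi : ℂ) ^ 2 * (k : ℂ) ^ 2) * Complex.I_mul_I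
          have e3 : ∀ A B : ℂ, A ^ (j : ℕ) * c * (B ^ (j : ℕ) * a) = (A * B) ^ (j : ℕ) * (c * a) := by
            intro A B
            rw [mul_pow]; ring
          rw [e3, e2, e1, ← pow_mul]
          push_cast
          rfl
        rw [e, Complex.ofReal_re]
      rw [h2] at h1
      have h3 := (Finset.sum_eq_zero_iff_of_nonneg (fun j _ => by
        have : 0 ≤ (2 * Real.pi * (k : ℝ)) ^ (2 * (j : ℕ)) := by
          rw [pow_mul]; positivity
        exact mul_nonneg this (Complex.normSq_nonneg a))).1 h1 0 (Finset.mem_univ _)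
      simpa using h3
    exact jets_ext h0
  have : Dense (LinearMap.range (incl n m).toLinearMap : Set (Sobolev n m)) :=
    Submodule.dense_iff_topologicalClosure_eq_top.2 key
  exact this

/-- The sc-Hilbert space `H = (W^{m,2}(S¹, ℝⁿ))_m`. -/
noncomputable def H (n : ℕ) : ScHilbertSpace where
  lvl m := Sobolev n m
  incl m := incl n m
  incl_injective m := incl_injective n m
  incl_compact m := incl_compact n m
  incl_dense m := incl_dense n m

theorem coord_bounded {n : ℕ} {x y : L2 n} (h : IsWeakDeriv x y) (i : Fin n) :
    ∃ C : ℝ, ∀ᵐ t ∂(haarAddCircle : Measure UnitAddCircle), |x t i| ≤ C := by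
  have hs : Summable (fun k => fourierCoeff (coord i x) k) := by
    have s1 : Summable fun k : ℤ => ‖fourierCoeff (coord i y) k‖ ^ 2 :=
      (hasSum_sq_fourierCoeff (coord i y)).summable
    have s2 : Summable fun k : ℤ => 1 / |(k : ℝ)| ^ 2 := by
      simpa using Real.summable_one_div_int_pow.2 (one_lt_two)
    refine Summable.of_norm_bounded_eventually (s1.add s2) ?_
    filter_upwards [(Set.finite_singleton (0 : ℤ)).compl_mem_cofinite] with k hk
    have hk : k ≠ 0 := hk
    have hk' : 0 < |(k : ℝ)| := abs_pos.2 (by exact_mod_cast hk)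
    have hn : ‖(2 * Real.pi * Complex.I * k : ℂ)‖ = 2 * Real.pi * |(k : ℝ)| := by
      simp [abs_of_pos Real.pi_pos]
    have e := congrArg norm (fourierCoeff_weakDeriv h i k)
    rw [norm_mul, hn] at e
    set a := ‖fourierCoeff (coord i x) k‖
    set b := ‖fourierCoeff (coord i y) k‖
    have ha : 0 ≤ a := norm_nonneg _
    have h1 : a ≤ b * (1 / |(k : ℝ)|) := by
      rw [mul_one_div, le_div_iff₀ hk', e]
      nlinarith [Real.pi_gt_three, mul_nonneg ha hk'.le]
    have h2 : (1 / |(k : ℝ)|) ^ 2 = 1 / |(k : ℝ)| ^ 2 := by rw [div_pow, one_pow]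
    rw [← h2]
    nlinarith [sq_nonneg (b - 1 / |(k : ℝ)|), sq_nonneg b, sq_nonneg (1 / |(k : ℝ)|)]
  have hs2 : Summable fun k : ℤ =>
      fourierCoeff (coord i x) k • (fourier k : C(UnitAddCircle, ℂ)) := by
    refine Summable.of_norm ?_
    have e : ∀ k : ℤ, ‖fourierCoeff (coord i x) k • (fourier k : C(UnitAddCircle, ℂ))‖ =
        ‖fourierCoeff (coord i x) k‖ := fun k => by rw [norm_smul, fourier_norm, mul_one]
    simpa only [e] using hs.norm
  obtain ⟨g, hg⟩ := hs2
  have hg2 := (ContinuousMap.toLp (E := ℂ) 2 (haarAddCircle : Measure UnitAddCircle) ℂ).hasSum hg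
  have e : ContinuousMap.toLp (E := ℂ) 2 (haarAddCircle : Measure UnitAddCircle) ℂ g =
      coord i x := by
    refine hg2.unique ?_
    simpa using hasSum_fourier_series_L2 (coord i x)
  have e2 := ContinuousMap.coeFn_toLp (𝕜 := ℂ) (p := 2) (haarAddCircle : Measure UnitAddCircle) g
  rw [e] at e2
  refine ⟨‖g‖, ?_⟩
  filter_upwards [e2, coord_ae i x] with t h1 h2
  rw [h1] at h2
  have := g.norm_coe_le_norm t
  rw [h2] at this
  simpa using this

/-- Elements of `H_1` are essentially bounded. -/
theorem ae_bounded {n : ℕ} (x : Sobolev n 1) :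
    ∃ C : ℝ, ∀ᵐ t ∂(haarAddCircle : Measure UnitAddCircle), ‖fn x t‖ ≤ C := by
  choose C hC using fun i => coord_bounded (isWeakDeriv_wderiv x) i
  refine ⟨Real.sqrt (∑ i, C i ^ 2), ?_⟩
  filter_upwards [ae_all_iff.2 hC] with t ht
  rw [EuclideanSpace.norm_eq]
  refine Real.sqrt_le_sqrt (Finset.sum_le_sum fun i _ => ?_)
  exact pow_le_pow_left₀ (norm_nonneg _) (ht i) 2

/-- `X : S¹ × ℝⁿ → ℝⁿ` is a smooth time-dependent vector field. -/
def IsSmoothVectorField {n : ℕ} (X : UnitAddCircle → Vec n → Vec n) : Prop :=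
  ContDiff ℝ ∞ (fun p : ℝ × Vec n => X (p.1 : UnitAddCircle) p.2)

theorem IsSmoothVectorField.continuous {n : ℕ} {X : UnitAddCircle → Vec n → Vec n}
    (hX : IsSmoothVectorField X) : Continuous fun p : UnitAddCircle × Vec n => X p.1 p.2 := by
  have h : IsOpenQuotientMap (Prod.map (fun t : ℝ => (t : UnitAddCircle)) (id : Vec n → Vec n)) :=
    QuotientAddGroup.isOpenQuotientMap_mk.prodMap IsOpenQuotientMap.id
  exact h.isQuotientMap.continuous_iff.2 (ContDiff.continuous hX)

/-- For `x ∈ H_1`, the map `t ↦ X_t(x(t))` is in `L²`. -/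
theorem memLp_superposition {n : ℕ} {X : UnitAddCircle → Vec n → Vec n}
    (hX : IsSmoothVectorField X) (x : Sobolev n 1) :
    MemLp (fun t => X t (fn x t)) 2 (haarAddCircle : Measure UnitAddCircle) := by
  obtain ⟨C, hC⟩ := ae_bounded x
  obtain ⟨M, hM⟩ := (isCompact_univ.prod (isCompact_closedBall (0 : Vec n) C)
    ).exists_bound_of_continuousOn (f := fun p : UnitAddCircle × Vec n => X p.1 p.2)
    hX.continuous.continuousOn
  refine MemLp.of_bound ?_ M ?_
  · exact hX.continuous.comp_aestronglyMeasurable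
      (aestronglyMeasurable_id.prodMk (Lp.aestronglyMeasurable (fn x)))
  · filter_upwards [hC] with t ht
    exact hM (t, fn x t) ⟨trivial, by simpa using ht⟩

/-- The superposition operator `x ↦ X(x)`, `X(x)(t) = X_t(x(t))`, from `H_1` to `L² = H_0`. -/
noncomputable def superposition {n : ℕ} {X : UnitAddCircle → Vec n → Vec n}
    (hX : IsSmoothVectorField X) (x : Sobolev n 1) : Sobolev n 0 :=
  ofL2 ((memLp_superposition hX x).toLp _)

/-- The base `ℝ × H^1`. -/
noncomputable def delayBase (n : ℕ) : ScHilbertSpace := (const ℝ).prod (H n).up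

/-- The point `(τ, x) ∈ (ℝ × H^1)_m = ℝ × H_{m+1}`. -/
noncomputable def pt {n : ℕ} (m : ℕ) (τ : ℝ) (x : Sobolev n (m + 1)) : (delayBase n).lvl m :=
  pair (const ℝ) (H n).up m τ x

/-- `s(τ, x) = ∂_t x - X(φ(τ, x))`. -/
noncomputable def delayMap {n : ℕ} {X : UnitAddCircle → Vec n → Vec n}
    (hX : IsSmoothVectorField X) (τ : ℝ) (x : Sobolev n 1) : Sobolev n 0 :=
  wderiv n 0 x - superposition hX (shift τ x)

/-- The section `S(τ, x) = (τ, x, s(τ, x))` of the trivial bundle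
`(ℝ × H^1) × H → ℝ × H^1`. -/
noncomputable def delaySection {n : ℕ} {X : UnitAddCircle → Vec n → Vec n}
    (hX : IsSmoothVectorField X) (p : (delayBase n).lvl 0) : ((delayBase n).prod (H n)).lvl 0 :=
  pair (delayBase n) (H n) 0 p
    (delayMap hX (proj₁ (const ℝ) (H n).up 0 p) (proj₂ (const ℝ) (H n).up 0 p))

end CircleSobolev

open CircleSobolev

/-! The principal part is `s = ∂_t - N ∘ φ`, with the shift `φ : ℝ × H^1 → H^1` and the
superposition operator `N : H^1 → H`, `N(y) = X(y)`. Since `∂_t` is linear and bounded at every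
level, everything rests on a calculus of sc-maps and on the sc-smoothness of `φ` and of `N`.

The calculus: a sc-differential at `x` is a Fréchet derivative of `f : E_1 → F_0` that extends to
`E_0` (`hasScDerivAt_iff`). These derivatives are jointly continuous in `(x, h)` but need not be
continuous in operator norm. Compactness of `E_1 → E_0` makes up for this, because joint continuity
is uniform over the compact closure of the image of the unit ball. This yields the chain rule
(`HasScDerivAt.comp`, `IsSc.comp`), and also that `sc^k` maps stay `sc^k` on the shifted scales
(`IsSc.up`). The latter controls the first component of a tangent map, so that an `sc^k` map `f` is
`sc^{k+1}` as soon as `(x, h) ↦ df(x)h` is `sc^k` (`IsSc.succ_of`).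

For `φ` and for `N` the induction on `k` closes because this second component is built from maps of
the same kind. For the shift it is `φ(τ, h) - T φ(τ, ∂_t x)` (`isSc_shiftMap`): the derivative lost
in `∂_t x` is the one that the tangent scale grants to `x`. The estimates are made on the Fourier
side, where the shift multiplies the `k`-th coefficient by `exp(-2πikτ)` (`hasScDerivAt_shiftMap`).
For `N` it is the superposition operator of `(t, (x, h)) ↦ dX_t(x)h`, hence the general setting of
maps from `ℝᵖ` to `ℝ^q` (`isSc_nemytskii`). Differentiability of `N` comes from the embedding of
`H_1` in `C(S¹)`, on which superposition is Fréchet differentiable (`hasFDerivAt_supC`). Continuity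
of `N : H_{m+1} → H_m` is an induction on `m`, as `∂_t N(x)` is again a superposition operator
applied to `(x, ∂_t x)` (`exists_continuous_lift`).

The formula for the differential is the chain rule for `N ∘ φ`. -/

namespace ScHilbertSpace

/-! ### Levels and products of scales. -/

theorem incl_toBase_up (E : ScHilbertSpace) (m : ℕ) (x : E.lvl (m + 1)) :
    E.incl 0 (E.up.toBase m x) = E.toBase (m + 1) x := by
  induction m with
  | zero => rfl
  | succ m ih => exact ih (E.incl (m + 1) x)

theorem toBase_prod (E F : ScHilbertSpace) (m : ℕ) (z : (E.prod F).lvl m) :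
    (E.prod F).toBase m z =
      pair E F 0 (E.toBase m (proj₁ E F m z)) (F.toBase m (proj₂ E F m z)) := by
  induction m with
  | zero => rfl
  | succ m ih => exact ih ((E.prod F).incl m z)

theorem prod_ext {E F : ScHilbertSpace} {m : ℕ} {z w : (E.prod F).lvl m}
    (h₁ : proj₁ E F m z = proj₁ E F m w) (h₂ : proj₂ E F m z = proj₂ E F m w) : z = w :=
  WithLp.ofLp_injective 2 (Prod.ext h₁ h₂)

/-- The projection to the first factor, at level `m`. -/
noncomputable def fstL (E F : ScHilbertSpace) (m : ℕ) : (E.prod F).lvl m →L[ℝ] E.lvl m :=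
  (ContinuousLinearMap.fst ℝ (E.lvl m) (F.lvl m)).comp
    (WithLp.prodContinuousLinearEquiv 2 ℝ (E.lvl m) (F.lvl m) :
      WithLp 2 (E.lvl m × F.lvl m) →L[ℝ] (E.lvl m × F.lvl m))

/-- The projection to the second factor, at level `m`. -/
noncomputable def sndL (E F : ScHilbertSpace) (m : ℕ) : (E.prod F).lvl m →L[ℝ] F.lvl m :=
  (ContinuousLinearMap.snd ℝ (E.lvl m) (F.lvl m)).comp
    (WithLp.prodContinuousLinearEquiv 2 ℝ (E.lvl m) (F.lvl m) :
      WithLp 2 (E.lvl m × F.lvl m) →L[ℝ] (E.lvl m × F.lvl m))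

/-- The operator to a product with the given components, at level `m`. -/
noncomputable def pairL {V : Type} [NormedAddCommGroup V] [NormedSpace ℝ V] (E F : ScHilbertSpace)
    (m : ℕ) (A : V →L[ℝ] E.lvl m) (B : V →L[ℝ] F.lvl m) : V →L[ℝ] (E.prod F).lvl m :=
  ((WithLp.prodContinuousLinearEquiv 2 ℝ (E.lvl m) (F.lvl m)).symm :
    (E.lvl m × F.lvl m) →L[ℝ] WithLp 2 (E.lvl m × F.lvl m)).comp (A.prod B)

theorem continuous_pair {V : Type*} [TopologicalSpace V] {E F : ScHilbertSpace} {m : ℕ}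
    {a : V → E.lvl m} {b : V → F.lvl m} (ha : Continuous a) (hb : Continuous b) :
    Continuous fun v => pair E F m (a v) (b v) :=
  (WithLp.prodContinuousLinearEquiv 2 ℝ (E.lvl m) (F.lvl m)).symm.continuous.comp (ha.prodMk hb)

theorem continuous_proj₁ {E F : ScHilbertSpace} {m : ℕ} : Continuous (proj₁ E F m) :=
  (fstL E F m).continuous

theorem continuous_proj₂ {E F : ScHilbertSpace} {m : ℕ} : Continuous (proj₂ E F m) :=
  (sndL E F m).continuous

/-! ### Sc-differentials, compactness and the chain rule. -/

/-- The defining limit is the Fréchet condition for the restriction of `f` to `E_1`. What a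
sc-differential adds is that the derivative factors through `E_0`. Ordinary calculus thus settles
the linear case, sums, pairs and products. -/
theorem hasScDerivAt_iff {E F : ScHilbertSpace} {f : E.lvl 0 → F.lvl 0} {x : E.lvl 1}
    {D : E.lvl 0 →L[ℝ] F.lvl 0} :
    HasScDerivAt f x D ↔ HasFDerivAt (fun y => f (E.incl 0 y)) (D.comp (E.incl 0)) x := by
  rw [hasFDerivAt_iff_isLittleO_nhds_zero]
  rfl

theorem HasScDerivAt.hasDerivAt_line {E F : ScHilbertSpace} {f : E.lvl 0 → F.lvl 0}
    {x h : E.lvl 1} {s : ℝ} {D : E.lvl 0 →L[ℝ] F.lvl 0} (hD : HasScDerivAt f (x + s • h) D) :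
    HasDerivAt (fun s : ℝ => f (E.incl 0 (x + s • h))) (D (E.incl 0 h)) s := by
  have h1 : HasDerivAt (fun s : ℝ => x + s • h) h s := by
    simpa using ((hasDerivAt_id s).smul_const h).const_add x
  exact HasFDerivAt.comp_hasDerivAt (l := fun y => f (E.incl 0 y)) s (hasScDerivAt_iff.1 hD) h1

/-- A mean value inequality for a curve which is differentiable in a weaker norm only. -/
theorem norm_sub_sub_le_of_hasDerivAt {V W : Type*} [NormedAddCommGroup V] [NormedSpace ℝ V]
    [CompleteSpace V] [NormedAddCommGroup W] [NormedSpace ℝ W] [CompleteSpace W] {J : V →L[ℝ] W}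
    (hJ : Function.Injective J) {c d : ℝ → V} (hd : Continuous d)
    (h : ∀ s, HasDerivAt (fun s => J (c s)) (J (d s)) s) {w : V} {C : ℝ}
    (hC : ∀ s ∈ Set.Icc (0 : ℝ) 1, ‖d s - w‖ ≤ C) : ‖c 1 - c 0 - w‖ ≤ C := by
  -- The fundamental theorem of calculus is available only after `J`. As `d` is continuous in `V`,
  -- its integral exists there, and injectivity of `J` brings the identity back to `V`.
  have e : c 1 - c 0 = ∫ s in (0 : ℝ)..1, d s := by
    apply hJ
    rw [← J.intervalIntegral_comp_comm (hd.intervalIntegrable _ _), map_sub]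
    exact (intervalIntegral.integral_eq_sub_of_hasDerivAt (fun s _ => h s)
      ((J.continuous.comp hd).intervalIntegrable _ _)).symm
  have e2 : c 1 - c 0 - w = ∫ s in (0 : ℝ)..1, (d s - w) := by
    rw [intervalIntegral.integral_sub (hd.intervalIntegrable _ _)
      (continuous_const.intervalIntegrable _ _), e]
    simp
  rw [e2]
  have := intervalIntegral.norm_integral_le_of_norm_le_const (a := (0 : ℝ)) (b := 1) (C := C)
    (f := fun s => d s - w) fun s hs => by
      rw [Set.uIoc_of_le zero_le_one] at hs
      exact hC s ⟨hs.1.le, hs.2⟩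
  simpa using this

/-- The tube lemma for `{y} × K`. The bound covers a thickening of `K` because in the chain rule the
difference quotients lie only near a compact set, not in it. -/
theorem exists_uniform_on_compact {P Q R : Type*} [PseudoMetricSpace P] [PseudoMetricSpace Q]
    [SeminormedAddCommGroup R] {B : P → Q → R} (hB : Continuous fun p : P × Q => B p.1 p.2)
    (y : P) {K : Set Q} (hK : IsCompact K) {ε : ℝ} (hε : 0 < ε) :
    ∃ δ > 0, ∀ z ∈ Metric.ball y δ, ∀ v ∈ Metric.thickening δ K, ‖B z v - B y v‖ < ε := by
  have hc : Continuous fun p : P × Q => ‖B p.1 p.2 - B y p.2‖ :=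
    (hB.sub (hB.comp (continuous_const.prodMk continuous_snd))).norm
  obtain ⟨u, v, hu, hv, hyu, hKv, huv⟩ := generalized_tube_lemma (isCompact_singleton (x := y)) hK
    (isOpen_Iio.preimage hc : IsOpen ((fun p : P × Q => ‖B p.1 p.2 - B y p.2‖) ⁻¹' Set.Iio ε))
    (by rintro ⟨a, b⟩ ⟨rfl, -⟩; simpa using hε)
  obtain ⟨δ₁, h₁, hδ₁⟩ := Metric.isOpen_iff.1 hu y (hyu rfl)
  obtain ⟨δ₂, h₂, hδ₂⟩ := hK.exists_thickening_subset_open hv hKv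
  refine ⟨min δ₁ δ₂, lt_min h₁ h₂, fun z hz w hw => ?_⟩
  exact @huv (z, w) ⟨hδ₁ (Metric.ball_subset_ball (min_le_left _ _) hz),
    hδ₂ (Metric.thickening_mono (min_le_right _ _) _ hw)⟩

theorem isCompact_closure_image_ball {V W : Type*} [NormedAddCommGroup V] [NormedSpace ℝ V]
    [NormedAddCommGroup W] [NormedSpace ℝ W] {J : V →L[ℝ] W} (hJ : IsCompactOperator J) :
    IsCompact (closure (J '' Metric.closedBall 0 1)) :=
  IsCompactOperator.isCompact_closure_image_closedBall (f := J.toLinearMap) hJ 1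

/-- A map with a continuous family of linear operators as directional derivatives in a weaker norm
is differentiable along a compact operator. -/
theorem isLittleO_of_hasDerivAt_line {U V W W' : Type*} [NormedAddCommGroup U] [NormedSpace ℝ U]
    [NormedAddCommGroup V] [NormedSpace ℝ V] [NormedAddCommGroup W] [NormedSpace ℝ W]
    [CompleteSpace W] [NormedAddCommGroup W'] [NormedSpace ℝ W'] [CompleteSpace W'] {I : U →L[ℝ] V}
    (hI : IsCompactOperator I) {J : W →L[ℝ] W'} (hJ : Function.Injective J) {f : V → W}
    {D : U → V →L[ℝ] W} (hc : Continuous fun p : U × V => D p.1 p.2)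
    (h : ∀ (x h : U) (s : ℝ),
      HasDerivAt (fun s : ℝ => J (f (I (x + s • h)))) (J (D (x + s • h) (I h))) s) (x : U) :
    (fun h => f (I (x + h)) - f (I x) - D x (I h)) =o[𝓝 0] fun h => h := by
  have hK := isCompact_closure_image_ball hI
  refine Asymptotics.isLittleO_iff.2 fun ε hε => ?_
  obtain ⟨δ, hδ, H⟩ := exists_uniform_on_compact (B := fun z v => D z v) hc x hK hε
  filter_upwards [Metric.ball_mem_nhds 0 hδ] with k h2
  by_cases h0 : k = 0
  · simp [h0]
  have hn : 0 < ‖k‖ := norm_pos_iff.2 h0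
  -- The normalised increment stays in a fixed compact set, so `D` is uniformly close to `D x` on
  -- it; rescaling by `‖k‖` gives the bound `ε * ‖k‖`.
  have hv : ‖k‖⁻¹ • I k ∈ Metric.thickening δ (closure (I '' Metric.closedBall 0 1)) := by
    refine Metric.self_subset_thickening hδ _ (subset_closure ⟨‖k‖⁻¹ • k, ?_, by simp⟩)
    simp [norm_smul, hn.ne']
  have e1 : I k = ‖k‖ • (‖k‖⁻¹ • I k) := by
    rw [smul_smul, mul_inv_cancel₀ hn.ne', one_smul]
  have := norm_sub_sub_le_of_hasDerivAt hJ
    (c := fun s : ℝ => f (I (x + s • k))) (d := fun s : ℝ => D (x + s • k) (I k))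
    (hc.comp (Continuous.prodMk (by fun_prop) continuous_const))
    (fun s => h x k s) (w := D x (I k)) (C := ε * ‖k‖)
    fun s hs => by
      rw [e1, map_smul, map_smul (D x), ← smul_sub, norm_smul, norm_norm, mul_comm]
      refine mul_le_mul_of_nonneg_right (H _ ?_ _ hv).le hn.le
      rw [mem_ball_iff_norm, add_sub_cancel_left, norm_smul, Real.norm_of_nonneg hs.1]
      exact (mul_le_of_le_one_left (norm_nonneg _) hs.2).trans_lt (by simpa using h2)
  simpa using this

/-- The chain rule for sc-differentials. -/
theorem HasScDerivAt.comp {E F G : ScHilbertSpace} {f : E.lvl 0 → F.lvl 0} {g : F.lvl 0 → G.lvl 0}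
    {f₁ : E.lvl 1 → F.lvl 1} (hf₁ : Continuous f₁)
    (hf : ∀ x, F.incl 0 (f₁ x) = f (E.incl 0 x)) {x : E.lvl 1} {A : E.lvl 0 →L[ℝ] F.lvl 0}
    (hA : HasScDerivAt f x A) {B : F.lvl 1 → F.lvl 0 →L[ℝ] G.lvl 0}
    (hB : ∀ y, HasScDerivAt g y (B y))
    (hBc : Continuous fun p : F.lvl 1 × F.lvl 0 => B p.1 p.2) :
    HasScDerivAt (fun z => g (f z)) x ((B (f₁ x)).comp A) := by
  set y := f₁ x with hy
  set k : E.lvl 1 → F.lvl 1 := fun h => f₁ (x + h) - y with hk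
  have hk0 : Filter.Tendsto k (𝓝 0) (𝓝 0) := by
    have : Continuous k := (hf₁.comp (continuous_const.add continuous_id)).sub continuous_const
    simpa [hk, hy] using this.tendsto 0
  have hA' : (fun h : E.lvl 1 => F.incl 0 (k h) - A (E.incl 0 h)) =o[𝓝 0] fun h => h := by
    refine hA.congr_left fun h => ?_
    rw [hk, map_sub, hf, hy, hf]
  have hK : IsCompact (closure ((A.comp (E.incl 0)) '' Metric.closedBall 0 1)) :=
    isCompact_closure_image_ball ((E.incl_compact 0).clm_comp A)
  -- The increment `k h` tends to `0` in `F_1`, but with no rate there. The rate comes from `F_0`,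
  -- where `k h` is `A h` up to `o(‖h‖)`; so sc-differentiability of `g` at `y` is not enough, and
  -- `g` is integrated along the segment from `y` to `y + k h`.
  have key : (fun h : E.lvl 1 => g (F.incl 0 (y + k h)) - g (F.incl 0 y) - B y (F.incl 0 (k h)))
      =o[𝓝 0] fun h => h := by
    rw [Asymptotics.isLittleO_iff]
    intro ε hε
    obtain ⟨δ, hδ, H⟩ := exists_uniform_on_compact (B := fun z v => B z v) hBc y hK hε
    have h1 := (Asymptotics.isLittleO_iff.1 hA') (half_pos hδ)
    have h2 := hk0 (Metric.ball_mem_nhds 0 hδ)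
    filter_upwards [h1, h2] with h h1 h2
    by_cases h0 : h = 0
    · have : k h = 0 := by simp [hk, h0, hy]
      rw [this, h0]
      simp
    have hn : 0 < ‖h‖ := norm_pos_iff.2 h0
    -- The quotient is within `δ / 2` of `A (h / ‖h‖)`, which lies in the compact set.
    have hv : ‖h‖⁻¹ • F.incl 0 (k h) ∈ Metric.thickening δ
        (closure ((A.comp (E.incl 0)) '' Metric.closedBall 0 1)) := by
      refine Metric.mem_thickening_iff.2 ⟨‖h‖⁻¹ • A (E.incl 0 h),
        subset_closure ⟨‖h‖⁻¹ • h, ?_, by simp⟩, ?_⟩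
      · simp [norm_smul, hn.ne']
      · rw [dist_eq_norm, ← smul_sub, norm_smul, norm_inv, norm_norm, inv_mul_lt_iff₀ hn]
        refine h1.trans_lt ?_
        nlinarith
    have e : F.incl 0 (k h) = ‖h‖ • (‖h‖⁻¹ • F.incl 0 (k h)) := by
      rw [smul_smul, mul_inv_cancel₀ hn.ne', one_smul]
    have := norm_sub_sub_le_of_hasDerivAt (J := ContinuousLinearMap.id ℝ (G.lvl 0))
      Function.injective_id (c := fun s : ℝ => g (F.incl 0 (y + s • k h)))
      (d := fun s : ℝ => B (y + s • k h) (F.incl 0 (k h)))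
      (hBc.comp (Continuous.prodMk (by fun_prop) continuous_const))
      (fun s => (hB (y + s • k h)).hasDerivAt_line) (w := B y (F.incl 0 (k h))) (C := ε * ‖h‖)
      fun s hs => by
        rw [e, map_smul, map_smul (B y), ← smul_sub, norm_smul, norm_norm, mul_comm]
        refine mul_le_mul_of_nonneg_right (H _ ?_ _ hv).le hn.le
        rw [mem_ball_iff_norm, add_sub_cancel_left, norm_smul, Real.norm_of_nonneg hs.1]
        exact (mul_le_of_le_one_left (norm_nonneg _) hs.2).trans_lt (by simpa using h2)
    simpa using this
  have h2 : (fun h : E.lvl 1 => B y (F.incl 0 (k h) - A (E.incl 0 h))) =o[𝓝 0] fun h => h :=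
    ((B y).isBigO_comp _ _).trans_isLittleO hA'
  refine (key.add h2).congr_left fun h => ?_
  have e1 : F.incl 0 (y + k h) = f (E.incl 0 (x + h)) := by rw [← hf]; simp [hk]
  rw [e1, hf]
  simp

/-! ### Compositions of `sc^k` maps and sc-operators. -/

theorem IsSc.isScContinuous {k : ℕ} {E F : ScHilbertSpace} {f : E.lvl 0 → F.lvl 0}
    (h : IsSc k f) : IsScContinuous f := by
  induction k with
  | zero => exact h
  | succ k ih => exact ih h.1

theorem IsScContinuous.continuous {E F : ScHilbertSpace} {f : E.lvl 0 → F.lvl 0}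
    (h : IsScContinuous f) : Continuous f := by
  obtain ⟨g, hg, e⟩ := h 0
  have : f = g := funext fun x => (e x).symm
  rwa [this]

theorem IsScContinuous.exists_one {E F : ScHilbertSpace} {f : E.lvl 0 → F.lvl 0}
    (h : IsScContinuous f) : ∃ f₁ : E.lvl 1 → F.lvl 1, Continuous f₁ ∧
      ∀ x, F.incl 0 (f₁ x) = f (E.incl 0 x) := h 1

theorem IsScContinuous.comp {E F G : ScHilbertSpace} {f : E.lvl 0 → F.lvl 0}
    {g : F.lvl 0 → G.lvl 0} (hg : IsScContinuous g) (hf : IsScContinuous f) :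
    IsScContinuous (fun x => g (f x)) := fun m => by
  obtain ⟨a, ha, ea⟩ := hf m
  obtain ⟨b, hb, eb⟩ := hg m
  exact ⟨fun x => b (a x), hb.comp ha, fun x => by rw [eb, ea]⟩

/-- The joint continuity of `(y, v) ↦ B y v` that the chain rule requires is read off from the
second component of the continuous map `Tg`. The level-one restriction of `f` places `f x` in `F_1`,
where `B` is defined. -/
theorem IsTangentMap.comp {E F G : ScHilbertSpace} {f : E.lvl 0 → F.lvl 0} {g : F.lvl 0 → G.lvl 0}
    {Tf : E.tangent.lvl 0 → F.tangent.lvl 0} {Tg : F.tangent.lvl 0 → G.tangent.lvl 0}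
    (hf : IsScContinuous f) (hTf : IsTangentMap f Tf) (hTg : IsTangentMap g Tg)
    (cTg : Continuous Tg) : IsTangentMap (fun x => g (f x)) (fun z => Tg (Tf z)) := by
  obtain ⟨A, hA, eA⟩ := hTf
  obtain ⟨B, hB, eB⟩ := hTg
  obtain ⟨f₁, cf₁, ef₁⟩ := hf.exists_one
  refine ⟨fun x => (B (f₁ x)).comp (A x), fun x => (hA x).comp cf₁ ef₁ hB ?_, fun x h => ?_⟩
  · have : (fun p : F.lvl 1 × F.lvl 0 => B p.1 p.2) =
        fun p => proj₂ G.up G 0 (Tg (pair F.up F 0 p.1 p.2)) := funext fun p => (eB p.1 p.2).2.symm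
    rw [this]
    exact continuous_proj₂.comp (cTg.comp (continuous_pair continuous_fst continuous_snd))
  · have e : Tf (pair E.up E 0 x h) = pair F.up F 0 (f₁ x) (A x h) := by
      refine prod_ext ?_ (eA x h).2
      apply F.incl_injective 0
      exact (eA x h).1.trans (ef₁ x).symm
    have h1 := eB (f₁ x) (A x h)
    rw [← e, ef₁] at h1
    exact h1

/-- The composition of `sc^k` maps is `sc^k`. -/
theorem IsSc.comp {k : ℕ} {E F G : ScHilbertSpace} {f : E.lvl 0 → F.lvl 0} {g : F.lvl 0 → G.lvl 0}
    (hg : IsSc k g) (hf : IsSc k f) : IsSc k (fun x => g (f x)) := by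
  induction k generalizing E F G with
  | zero => exact IsScContinuous.comp hg hf
  | succ k ih =>
    obtain ⟨hg, Tg, tg, hTg⟩ := hg
    obtain ⟨hf, Tf, tf, hTf⟩ := hf
    exact ⟨ih hg hf, fun z => Tg (Tf z),
      tf.comp hf.isScContinuous tg hTg.isScContinuous.continuous, ih hTg hTf⟩

/-- `A` is a sc-operator: it restricts to a bounded operator at every level. -/
def IsScLinear {E F : ScHilbertSpace} (A : E.lvl 0 →L[ℝ] F.lvl 0) : Prop :=
  ∀ m, ∃ B : E.lvl m →L[ℝ] F.lvl m, ∀ x, F.toBase m (B x) = A (E.toBase m x)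

theorem hasScDerivAt_linear {E F : ScHilbertSpace} (A : E.lvl 0 →L[ℝ] F.lvl 0) (x : E.lvl 1) :
    HasScDerivAt A x A :=
  hasScDerivAt_iff.2 (A.comp (E.incl 0)).hasFDerivAt

/-- Sc-operators are sc-smooth. -/
theorem IsScLinear.isSc {E F : ScHilbertSpace} {A : E.lvl 0 →L[ℝ] F.lvl 0} (hA : IsScLinear A)
    (k : ℕ) : IsSc k A := by
  induction k generalizing E F with
  | zero => exact fun m => ⟨(hA m).choose, (hA m).choose.continuous, (hA m).choose_spec⟩
  | succ k ih =>
    refine ⟨ih hA, ?_⟩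
    choose B hB using hA
    have e1 : ∀ x, F.incl 0 (B 1 x) = A (E.incl 0 x) := hB 1
    -- The tangent map of a sc-operator is the sc-operator `(x, h) ↦ (A x, A h)`, so the induction
    -- applies to it.
    let T : E.tangent.lvl 0 →L[ℝ] F.tangent.lvl 0 := prodMapL2 (B 1) A
    refine ⟨T, ⟨fun _ => A, fun x => hasScDerivAt_linear A x, fun x h => ⟨e1 x, rfl⟩⟩, ih ?_⟩
    refine fun m => ⟨prodMapL2 (B (m + 1)) (B m), fun z => ?_⟩
    refine (toBase_prod F.up F m _).trans
      (Eq.trans ?_ (congrArg T (toBase_prod E.up E m z)).symm)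
    refine prod_ext (F.incl_injective 0 ?_) (hB m _)
    refine (incl_toBase_up F m _).trans ((hB (m + 1) _).trans ?_)
    refine (congrArg A (incl_toBase_up E m (proj₁ E.up E m z)).symm).trans (e1 _).symm

/-! ### Passage to the shifted scales. -/

theorem IsScContinuous.up {E F : ScHilbertSpace} {f : E.lvl 0 → F.lvl 0} (h : IsScContinuous f)
    {f₁ : E.up.lvl 0 → F.up.lvl 0} (e : ∀ x, F.incl 0 (f₁ x) = f (E.incl 0 x)) :
    IsScContinuous f₁ := fun m => by
  obtain ⟨g, hg, eg⟩ := h (m + 1)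
  refine ⟨g, hg, fun x => F.incl_injective 0 ?_⟩
  exact (incl_toBase_up F m (g x)).trans ((eg x).trans
    ((congrArg f (incl_toBase_up E m x).symm).trans (e _).symm))

/-- A sc-differentiable map is also sc-differentiable as a map between the shifted scales. -/
theorem HasScDerivAt.up {E F : ScHilbertSpace} {f : E.lvl 0 → F.lvl 0}
    {D : E.lvl 1 → E.lvl 0 →L[ℝ] F.lvl 0} (hD : ∀ x, HasScDerivAt f x (D x))
    {f₁ : E.up.lvl 0 → F.up.lvl 0} (e : ∀ x, F.incl 0 (f₁ x) = f (E.incl 0 x))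
    {D₁ : E.up.lvl 1 → E.up.lvl 0 →L[ℝ] F.up.lvl 0}
    (eD : ∀ x h, F.incl 0 (D₁ x h) = D (E.incl 1 x) (E.incl 0 h))
    (hc : Continuous fun p : E.up.lvl 1 × E.up.lvl 0 => D₁ p.1 p.2) (x : E.up.lvl 1) :
    HasScDerivAt f₁ x (D₁ x) := by
  -- Differentiability of `f` is known only in the norm of `F_0`. The mean value inequality along
  -- segments, with `D₁` jointly continuous into `F_1` and `E_2 → E_1` compact, upgrades it to the
  -- norm of `F_1`.
  refine isLittleO_of_hasDerivAt_line (I := E.incl 1) (E.incl_compact 1) (F.incl_injective 0)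
    (f := f₁) (D := D₁) hc (fun x h s => ?_) x
  have e' : ∀ s : ℝ, E.incl 1 (x + s • h) = E.incl 1 x + s • E.incl 1 h := fun s => by
    rw [map_add, map_smul]
  have key : HasDerivAt (fun s : ℝ => f (E.incl 0 (E.incl 1 x + s • E.incl 1 h)))
      (D (E.incl 1 (x + s • h)) (E.incl 0 (E.incl 1 h))) s := by
    refine HasScDerivAt.hasDerivAt_line ?_
    rw [e']
    exact hD _
  refine (key.congr_deriv (eD _ _).symm).congr_of_eventuallyEq (.of_forall fun s => ?_)
  exact (e _).trans (congrArg (fun y => f (E.incl 0 y)) (e' s))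

/-- An `sc^k` map is also `sc^k` as a map between the shifted scales. -/
theorem IsSc.up {k : ℕ} {E F : ScHilbertSpace} {f : E.lvl 0 → F.lvl 0} (h : IsSc k f)
    {f₁ : E.up.lvl 0 → F.up.lvl 0} (e : ∀ x, F.incl 0 (f₁ x) = f (E.incl 0 x)) : IsSc k f₁ := by
  induction k generalizing E F with
  | zero => exact IsScContinuous.up h e
  | succ k ih =>
    obtain ⟨hf, T, ⟨D, hD, eT⟩, hT⟩ := h
    refine ⟨ih hf e, ?_⟩
    -- The restriction of the tangent map to level one supplies both the candidate `D₁` for the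
    -- differential on the shifted scale and its joint continuity. Linearity of `D₁` is checked in
    -- `F_0`.
    obtain ⟨T₁, cT₁, eT₁⟩ := hT.isScContinuous.exists_one
    have eD : ∀ (x : E.lvl 2) (h : E.lvl 1),
        F.incl 0 (proj₂ F.up F 1 (T₁ (pair E.up E 1 x h))) = D (E.incl 1 x) (E.incl 0 h) :=
      fun x h => (congrArg (proj₂ F.up F 0) (eT₁ (pair E.up E 1 x h))).trans (eT _ _).2
    have eI : ∀ (x : E.lvl 2) (h : E.lvl 1),
        F.incl 1 (proj₁ F.up F 1 (T₁ (pair E.up E 1 x h))) = f₁ (E.incl 1 x) := fun x h => by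
      apply F.incl_injective 0
      have h1 := (congrArg (proj₁ F.up F 0) (eT₁ (pair E.up E 1 x h)))
      have h2 := (congrArg (F.incl 0) h1).trans (eT (E.incl 1 x) (E.incl 0 h)).1
      exact h2.trans (e _).symm
    have c2 : Continuous fun p : E.lvl 2 × E.lvl 1 =>
        proj₂ F.up F 1 (T₁ (pair E.up E 1 p.1 p.2)) :=
      continuous_proj₂.comp (cT₁.comp (continuous_pair continuous_fst continuous_snd))
    let D₁ : E.lvl 2 → E.lvl 1 →L[ℝ] F.lvl 1 := fun x =>
      { toFun := fun h => proj₂ F.up F 1 (T₁ (pair E.up E 1 x h))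
        map_add' := fun a b => F.incl_injective 0 (by simp only [eD, map_add])
        map_smul' := fun a b => F.incl_injective 0 (by simp only [eD, map_smul, RingHom.id_apply])
        cont := c2.comp (continuous_const.prodMk continuous_id) }
    refine ⟨T₁, ⟨D₁, HasScDerivAt.up hD e eD c2, fun x h => ⟨eI x h, rfl⟩⟩, ?_⟩
    -- Forming tangents and shifting commute: `E.tangent.up` and `E.up.tangent` agree by definition.
    exact ih (E := E.tangent) (F := F.tangent) hT eT₁

/-! ### Pairs, sums and a criterion for `sc^{k+1}`. -/

theorem isScLinear_fst (E F : ScHilbertSpace) : IsScLinear (fstL E F 0) := fun m =>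
  ⟨fstL E F m, fun z => by rw [toBase_prod]; rfl⟩

theorem isScLinear_snd (E F : ScHilbertSpace) : IsScLinear (sndL E F 0) := fun m =>
  ⟨sndL E F m, fun z => by rw [toBase_prod]; rfl⟩

theorem isScLinear_id (E : ScHilbertSpace) : IsScLinear (ContinuousLinearMap.id ℝ (E.lvl 0)) :=
  fun _ => ⟨.id ℝ _, fun _ => rfl⟩

theorem isScLinear_incl (E : ScHilbertSpace) : IsScLinear (E := E.up) (F := E) (E.incl 0) :=
  fun m => ⟨E.incl m, fun x => (incl_toBase_up E m x).symm⟩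

theorem IsScLinear.comp {E F G : ScHilbertSpace} {B : F.lvl 0 →L[ℝ] G.lvl 0}
    {A : E.lvl 0 →L[ℝ] F.lvl 0} (hB : IsScLinear B) (hA : IsScLinear A) :
    IsScLinear (B.comp A) := fun m => by
  obtain ⟨a, ha⟩ := hA m
  obtain ⟨b, hb⟩ := hB m
  exact ⟨b.comp a, fun x => by simp [hb, ha]⟩

theorem IsScLinear.pair {E F G : ScHilbertSpace} {A : E.lvl 0 →L[ℝ] F.lvl 0}
    {B : E.lvl 0 →L[ℝ] G.lvl 0} (hA : IsScLinear A) (hB : IsScLinear B) :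
    IsScLinear (pairL F G 0 A B) := fun m => by
  obtain ⟨a, ha⟩ := hA m
  obtain ⟨b, hb⟩ := hB m
  refine ⟨pairL F G m a b, fun x => ?_⟩
  rw [toBase_prod]
  exact prod_ext (ha x) (hb x)

theorem IsScLinear.add {E F : ScHilbertSpace} {A B : E.lvl 0 →L[ℝ] F.lvl 0}
    (hA : IsScLinear A) (hB : IsScLinear B) : IsScLinear (A + B) := fun m => by
  obtain ⟨a, ha⟩ := hA m
  obtain ⟨b, hb⟩ := hB m
  exact ⟨a + b, fun x => by simp [hb, ha]⟩

theorem IsScLinear.neg {E F : ScHilbertSpace} {A : E.lvl 0 →L[ℝ] F.lvl 0}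
    (hA : IsScLinear A) : IsScLinear (-A) := fun m => by
  obtain ⟨a, ha⟩ := hA m
  exact ⟨-a, fun x => by simp [ha]⟩

theorem IsScContinuous.pair {E F G : ScHilbertSpace} {f : E.lvl 0 → F.lvl 0}
    {g : E.lvl 0 → G.lvl 0} (hf : IsScContinuous f) (hg : IsScContinuous g) :
    IsScContinuous (fun x => pair F G 0 (f x) (g x)) := fun m => by
  obtain ⟨a, ca, ha⟩ := hf m
  obtain ⟨b, cb, hb⟩ := hg m
  refine ⟨fun x => ScHilbertSpace.pair F G m (a x) (b x), continuous_pair ca cb, fun x => ?_⟩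
  rw [toBase_prod]
  exact prod_ext (ha x) (hb x)

theorem HasScDerivAt.pair {E F G : ScHilbertSpace} {f : E.lvl 0 → F.lvl 0} {g : E.lvl 0 → G.lvl 0}
    {x : E.lvl 1} {A : E.lvl 0 →L[ℝ] F.lvl 0} {B : E.lvl 0 →L[ℝ] G.lvl 0}
    (hA : HasScDerivAt f x A) (hB : HasScDerivAt g x B) :
    HasScDerivAt (fun x => pair F G 0 (f x) (g x)) x (pairL F G 0 A B) := by
  rw [hasScDerivAt_iff] at *
  exact ((WithLp.prodContinuousLinearEquiv 2 ℝ (F.lvl 0) (G.lvl 0)).symm :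
    (F.lvl 0 × G.lvl 0) →L[ℝ] WithLp 2 (F.lvl 0 × G.lvl 0)).hasFDerivAt.comp x (hA.prodMk hB)

theorem HasScDerivAt.sub {E F : ScHilbertSpace} {f g : E.lvl 0 → F.lvl 0}
    {x : E.lvl 1} {A B : E.lvl 0 →L[ℝ] F.lvl 0} (hA : HasScDerivAt f x A)
    (hB : HasScDerivAt g x B) : HasScDerivAt (fun x => f x - g x) x (A - B) := by
  rw [hasScDerivAt_iff] at *
  exact HasFDerivAt.sub hA hB

/-- The rearrangement `TF × TG → T(F × G)`. -/
noncomputable def tangentProd (F G : ScHilbertSpace) :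
    (F.tangent.prod G.tangent).lvl 0 →L[ℝ] (F.prod G).tangent.lvl 0 :=
  pairL (F.prod G).up (F.prod G) 0
    (pairL F.up G.up 0 ((fstL F.up F 0).comp (fstL F.tangent G.tangent 0))
      ((fstL G.up G 0).comp (sndL F.tangent G.tangent 0)))
    (pairL F G 0 ((sndL F.up F 0).comp (fstL F.tangent G.tangent 0))
      ((sndL G.up G 0).comp (sndL F.tangent G.tangent 0)))

theorem isScLinear_tangentProd (F G : ScHilbertSpace) : IsScLinear (tangentProd F G) :=
  IsScLinear.pair (F := (F.prod G).up) (G := F.prod G)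
    (IsScLinear.pair (F := F.up) (G := G.up)
      ((isScLinear_fst F.up F).comp (isScLinear_fst F.tangent G.tangent))
      ((isScLinear_fst G.up G).comp (isScLinear_snd F.tangent G.tangent)))
    (((isScLinear_snd F.up F).comp (isScLinear_fst F.tangent G.tangent)).pair
      ((isScLinear_snd G.up G).comp (isScLinear_snd F.tangent G.tangent)))

/-- A map to a product is `sc^k` if its components are. -/
theorem IsSc.pair {k : ℕ} {E F G : ScHilbertSpace} {f : E.lvl 0 → F.lvl 0} {g : E.lvl 0 → G.lvl 0}
    (hf : IsSc k f) (hg : IsSc k g) : IsSc k (fun x => pair F G 0 (f x) (g x)) := by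
  induction k generalizing E F G with
  | zero => exact IsScContinuous.pair hf hg
  | succ k ih =>
    obtain ⟨hf, Tf, ⟨A, hA, eA⟩, hTf⟩ := hf
    obtain ⟨hg, Tg, ⟨B, hB, eB⟩, hTg⟩ := hg
    refine ⟨ih hf hg,
      fun z => tangentProd F G (ScHilbertSpace.pair F.tangent G.tangent 0 (Tf z) (Tg z)),
      ⟨fun x => pairL F G 0 (A x) (B x), fun x => (hA x).pair (hB x), fun x h => ⟨?_, ?_⟩⟩,
      IsSc.comp ((isScLinear_tangentProd F G).isSc k) (ih hTf hTg)⟩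
    · exact prod_ext (eA x h).1 (eB x h).1
    · exact prod_ext (eA x h).2 (eB x h).2

theorem IsSc.add {k : ℕ} {E F : ScHilbertSpace} {f g : E.lvl 0 → F.lvl 0}
    (hf : IsSc k f) (hg : IsSc k g) : IsSc k (fun x => f x + g x) :=
  (((isScLinear_fst F F).add (isScLinear_snd F F)).isSc k).comp (hf.pair hg)

theorem IsSc.sub {k : ℕ} {E F : ScHilbertSpace} {f g : E.lvl 0 → F.lvl 0}
    (hf : IsSc k f) (hg : IsSc k g) : IsSc k (fun x => f x - g x) := by
  have := (((isScLinear_fst F F).add (isScLinear_snd F F).neg).isSc k).comp (hf.pair hg)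
  refine (congrArg (IsSc k) (funext fun x => ?_)).mpr this
  exact sub_eq_add_neg _ _

/-- A criterion for a map to be `sc^{k+1}`. -/
theorem IsSc.succ_of {k : ℕ} {E F : ScHilbertSpace} {f : E.lvl 0 → F.lvl 0} (hf : IsSc k f)
    {D : E.lvl 1 → E.lvl 0 →L[ℝ] F.lvl 0} (hD : ∀ x, HasScDerivAt f x (D x))
    {ψ : E.tangent.lvl 0 → F.lvl 0} (hψ : IsSc k ψ)
    (e : ∀ x h, ψ (ScHilbertSpace.pair E.up E 0 x h) = D x h) : IsSc (k + 1) f := by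
  -- The first component of the tangent map is `f` on the shifted scales, which is `sc^k` by
  -- `IsSc.up`; only the second component `ψ` needs a hypothesis.
  obtain ⟨f₁, -, e₁⟩ := hf.isScContinuous.exists_one
  have h₁ : IsSc (E := E.up) (F := F.up) k f₁ := hf.up e₁
  refine ⟨hf, fun z => ScHilbertSpace.pair F.up F 0 (f₁ (fstL E.up E 0 z)) (ψ z),
    ⟨D, hD, fun x h => ⟨e₁ x, e x h⟩⟩, ?_⟩
  exact IsSc.pair (E := E.tangent) (F := F.up) (G := F)
    (h₁.comp ((isScLinear_fst E.up E).isSc k)) hψ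

/-! ### Scalar multiplication. -/

/-- Scalar multiplication `ℝ × E → E`. -/
noncomputable def smulMap (E : ScHilbertSpace) (z : ((const ℝ).prod E).lvl 0) : E.lvl 0 :=
  (show ℝ from proj₁ (const ℝ) E 0 z) • proj₂ (const ℝ) E 0 z

theorem toBase_const (V : Type) [NormedAddCommGroup V] [InnerProductSpace ℝ V]
    [FiniteDimensional ℝ V] (m : ℕ) (v : V) : (const V).toBase m v = v := by
  induction m with
  | zero => rfl
  | succ m ih => exact ih

theorem isScContinuous_smulMap (E : ScHilbertSpace) : IsScContinuous (smulMap E) := fun m => by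
  refine ⟨fun z => (show ℝ from proj₁ (const ℝ) E m z) • proj₂ (const ℝ) E m z, ?_, fun z => ?_⟩
  · exact Continuous.smul (M := ℝ) (continuous_proj₁ (E := const ℝ) (F := E) (m := m))
      continuous_proj₂
  · rw [toBase_prod, map_smul]
    exact congrArg (fun c : ℝ => c • E.toBase m (proj₂ (const ℝ) E m z))
      (toBase_const ℝ m (proj₁ (const ℝ) E m z)).symm

/-- Scalar multiplication is sc-smooth. -/
theorem isSc_smulMap (k : ℕ) (E : ScHilbertSpace) : IsSc k (smulMap E) := by
  induction k with
  | zero => exact isScContinuous_smulMap E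
  | succ k ih =>
    let P := (const ℝ).prod E
    let D : P.lvl 1 → P.lvl 0 →L[ℝ] E.lvl 0 := fun x =>
      (show ℝ from proj₁ (const ℝ) E 1 x) • sndL (const ℝ) E 0 +
        (ContinuousLinearMap.toSpanSingleton ℝ (E.incl 0 (proj₂ (const ℝ) E 1 x))).comp
          (fstL (const ℝ) E 0 : P.lvl 0 →L[ℝ] ℝ)
    -- By the product rule the differential at `(c, v)` in direction `(c', v')` is `c • v' + c' •
    -- v`: `smulMap` composed with the two sc-operators `h1` and `h2`.
    have h1 : IsScLinear (E := P.tangent) (F := P)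
        (pairL (const ℝ) E 0 ((fstL (const ℝ) E.up 0).comp (fstL P.up P 0))
          ((sndL (const ℝ) E 0).comp (sndL P.up P 0))) :=
      ((isScLinear_fst (const ℝ) E.up).comp (isScLinear_fst P.up P)).pair
        ((isScLinear_snd (const ℝ) E).comp (isScLinear_snd P.up P))
    have h2 : IsScLinear (E := P.tangent) (F := P)
        (pairL (const ℝ) E 0 ((fstL (const ℝ) E 0).comp (sndL P.up P 0))
          ((E.incl 0).comp ((sndL (const ℝ) E.up 0).comp (fstL P.up P 0)))) :=
      ((isScLinear_fst (const ℝ) E).comp (isScLinear_snd P.up P)).pair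
        ((isScLinear_incl E).comp ((isScLinear_snd (const ℝ) E.up).comp (isScLinear_fst P.up P)))
    refine IsSc.succ_of ih (D := D) (fun x => ?_)
      ((ih.comp (h1.isSc k)).add (ih.comp (h2.isSc k))) fun x h => rfl
    rw [hasScDerivAt_iff]
    have d1 : HasFDerivAt (fun z : P.lvl 1 => (show ℝ from proj₁ (const ℝ) E 1 z))
        (fstL (const ℝ) E 1 : P.lvl 1 →L[ℝ] ℝ) x :=
      (fstL (const ℝ) E 1 : P.lvl 1 →L[ℝ] ℝ).hasFDerivAt
    have d2 : HasFDerivAt (fun z : P.lvl 1 => E.incl 0 (proj₂ (const ℝ) E 1 z))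
        ((E.incl 0).comp (sndL (const ℝ) E 1)) x :=
      ((E.incl 0).comp (sndL (const ℝ) E 1)).hasFDerivAt
    exact d1.smul d2

end ScHilbertSpace

namespace CircleSobolev

open AddCircle ScHilbertSpace

/-! ### The Sobolev embedding `H_1 → C(S¹, ℝⁿ)`. -/

theorem fn_toBase {n : ℕ} (m : ℕ) (x : Sobolev n m) :
    fn ((H n).toBase m x : Sobolev n 0) = fn x := by
  induction m with
  | zero => rfl
  | succ m ih => exact ih (incl n m x)

theorem fn_toBase_up {n : ℕ} (m : ℕ) (x : Sobolev n (m + 1)) :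
    fn ((H n).up.toBase m x : Sobolev n 1) = fn x := by
  induction m with
  | zero => rfl
  | succ m ih => exact ih (incl n (m + 1) x)

/-- The `L²` class of a continuous function. -/
noncomputable def toL2 {n : ℕ} : C(UnitAddCircle, Vec n) →L[ℝ] L2 n :=
  ContinuousMap.toLp 2 haarAddCircle ℝ

theorem toL2_ae {n : ℕ} (f : C(UnitAddCircle, Vec n)) : toL2 f =ᵐ[haarAddCircle] f :=
  ContinuousMap.coeFn_toLp (𝕜 := ℝ) haarAddCircle f

theorem toL2_injective {n : ℕ} : Function.Injective (toL2 : C(UnitAddCircle, Vec n) → L2 n) :=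
  ContinuousMap.toLp_injective haarAddCircle

/-- For `k ≠ 0` the `k`-th coefficient of `x` is that of `y` divided by `2πik`, so its norm is at
most `|ŷ(k)|² + 1/k²`. Hence the Fourier series of `x` converges uniformly, and its sum is the
continuous representative. -/
theorem exists_continuous_coord {n : ℕ} {x y : L2 n} (h : IsWeakDeriv x y) (i : Fin n) :
    ∃ g : C(UnitAddCircle, ℂ), g =ᵐ[haarAddCircle] coord i x := by
  have hs : Summable (fun k => fourierCoeff (coord i x) k) := by
    have s1 : Summable fun k : ℤ => ‖fourierCoeff (coord i y) k‖ ^ 2 :=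
      (hasSum_sq_fourierCoeff (coord i y)).summable
    have s2 : Summable fun k : ℤ => 1 / |(k : ℝ)| ^ 2 := by
      simpa using Real.summable_one_div_int_pow.2 (one_lt_two)
    refine Summable.of_norm_bounded_eventually (s1.add s2) ?_
    filter_upwards [(Set.finite_singleton (0 : ℤ)).compl_mem_cofinite] with k hk
    have hk : k ≠ 0 := hk
    have hk' : 0 < |(k : ℝ)| := abs_pos.2 (by exact_mod_cast hk)
    have hn : ‖(2 * Real.pi * Complex.I * k : ℂ)‖ = 2 * Real.pi * |(k : ℝ)| := by
      simp [abs_of_pos Real.pi_pos]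
    have e := congrArg norm (fourierCoeff_weakDeriv h i k)
    rw [norm_mul, hn] at e
    set a := ‖fourierCoeff (coord i x) k‖
    set b := ‖fourierCoeff (coord i y) k‖
    have ha : 0 ≤ a := norm_nonneg _
    have h1 : a ≤ b * (1 / |(k : ℝ)|) := by
      rw [mul_one_div, le_div_iff₀ hk', e]
      nlinarith [Real.pi_gt_three, mul_nonneg ha hk'.le]
    have h2 : (1 / |(k : ℝ)|) ^ 2 = 1 / |(k : ℝ)| ^ 2 := by rw [div_pow, one_pow]
    rw [← h2]
    nlinarith [sq_nonneg (b - 1 / |(k : ℝ)|), sq_nonneg b, sq_nonneg (1 / |(k : ℝ)|)]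
  have hs2 : Summable fun k : ℤ =>
      fourierCoeff (coord i x) k • (fourier k : C(UnitAddCircle, ℂ)) := by
    refine Summable.of_norm ?_
    have e : ∀ k : ℤ, ‖fourierCoeff (coord i x) k • (fourier k : C(UnitAddCircle, ℂ))‖ =
        ‖fourierCoeff (coord i x) k‖ := fun k => by rw [norm_smul, fourier_norm, mul_one]
    simpa only [e] using hs.norm
  obtain ⟨g, hg⟩ := hs2
  have hg2 := (ContinuousMap.toLp (E := ℂ) 2 (haarAddCircle : Measure UnitAddCircle) ℂ).hasSum hg
  have e : ContinuousMap.toLp (E := ℂ) 2 (haarAddCircle : Measure UnitAddCircle) ℂ g =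
      coord i x := by
    refine hg2.unique ?_
    simpa using hasSum_fourier_series_L2 (coord i x)
  refine ⟨g, ?_⟩
  rw [← e]
  exact (ContinuousMap.coeFn_toLp (𝕜 := ℂ) (p := 2) haarAddCircle g).symm

/-- Elements of `H_1` have a continuous representative. -/
theorem exists_toL2_eq {n : ℕ} (x : Sobolev n 1) : ∃ g, toL2 g = fn x := by
  choose g hg using fun i => exists_continuous_coord (isWeakDeriv_wderiv x) i
  refine ⟨⟨fun t => WithLp.toLp 2 fun i => (g i t).re, ?_⟩, Lp.ext ?_⟩
  · exact (PiLp.continuous_toLp 2 _).comp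
      (continuous_pi fun i => Complex.continuous_re.comp (g i).continuous)
  · filter_upwards [toL2_ae ⟨fun t => WithLp.toLp 2 fun i => (g i t).re, _⟩, ae_all_iff.2 hg,
      ae_all_iff.2 fun i => coord_ae i (fn x)] with t h1 h2 h3
    rw [h1]
    refine PiLp.ext fun i => ?_
    change (g i t).re = _
    rw [h2, h3, Complex.ofReal_re]

/-- The Sobolev embedding `H_1 → C(S¹, ℝⁿ)`, as a linear map. -/
noncomputable def repLM (n : ℕ) : Sobolev n 1 →ₗ[ℝ] C(UnitAddCircle, Vec n) where
  toFun x := (exists_toL2_eq x).choose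
  map_add' x y := toL2_injective (by
    refine (exists_toL2_eq _).choose_spec.trans ?_
    rw [map_add toL2, (exists_toL2_eq x).choose_spec, (exists_toL2_eq y).choose_spec, map_add])
  map_smul' c x := toL2_injective (by
    refine (exists_toL2_eq _).choose_spec.trans ?_
    rw [map_smul toL2, (exists_toL2_eq x).choose_spec, map_smul, RingHom.id_apply])

theorem toL2_repLM {n : ℕ} (x : Sobolev n 1) : toL2 (repLM n x) = fn x :=
  (exists_toL2_eq x).choose_spec

/-- The Sobolev embedding `H_1 → C(S¹, ℝⁿ)`. -/
noncomputable def rep {n : ℕ} : Sobolev n 1 →L[ℝ] C(UnitAddCircle, Vec n) where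
  toLinearMap := repLM n
  cont := by
    -- Closed graph theorem: the graph is cut out by an equation between continuous maps to `L²`.
    refine LinearMap.continuous_of_isClosed_graph _ ?_
    have e : ((repLM n).graph : Set (Sobolev n 1 × C(UnitAddCircle, Vec n))) =
        {p | toL2 p.2 = fn p.1} := by
      ext p
      simp only [SetLike.mem_coe, LinearMap.mem_graph_iff, Set.mem_ofPred_eq, ← toL2_repLM]
      exact toL2_injective.eq_iff.symm
    rw [e]
    exact isClosed_eq (toL2.continuous.comp continuous_snd) (fn.continuous.comp continuous_fst)

theorem toL2_rep {n : ℕ} (x : Sobolev n 1) : toL2 (rep x) = fn x := toL2_repLM x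

theorem rep_ae {n : ℕ} (x : Sobolev n 1) : fn x =ᵐ[haarAddCircle] rep x := by
  rw [← toL2_rep]
  exact toL2_ae _

/-! ### Classical and weak derivatives. -/

theorem integral_eq_intervalIntegral {V : Type*} [NormedAddCommGroup V] [NormedSpace ℝ V]
    (f : UnitAddCircle → V) :
    ∫ t, f t ∂(haarAddCircle : Measure UnitAddCircle) = ∫ t in (0 : ℝ)..1, f t := by
  rw [integral_haarAddCircle, inv_one, one_smul, ← AddCircle.intervalIntegral_preimage 1 0 f,
    zero_add]

/-- Integration by parts: `φ • u` takes the same value at `0` and at `1`, so its derivative has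
integral zero over a period. -/
theorem isWeakDeriv_toL2 {n : ℕ} {u v : C(UnitAddCircle, Vec n)}
    (h : ∀ t : ℝ, HasDerivAt (fun s : ℝ => u s) (v t) t) : IsWeakDeriv (toL2 u) (toL2 v) := by
  intro φ ψ hφ hψ
  obtain ⟨cφ, cψ⟩ := continuous_of_test hφ hψ
  have c0 : Continuous fun t : ℝ => (t : UnitAddCircle) := AddCircle.continuous_mk' 1
  have e1 : ∫ t, ψ t • toL2 u t ∂haarAddCircle = ∫ t in (0 : ℝ)..1, ψ t • u t := by
    rw [← integral_eq_intervalIntegral fun t => ψ t • u t]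
    exact integral_congr_ae ((toL2_ae u).mono fun t ht => by simp only [ht])
  have e2 : ∫ t, φ t • toL2 v t ∂haarAddCircle = ∫ t in (0 : ℝ)..1, φ t • v t := by
    rw [← integral_eq_intervalIntegral fun t => φ t • v t]
    exact integral_congr_ae ((toL2_ae v).mono fun t ht => by simp only [ht])
  have i1 : IntervalIntegrable (fun t : ℝ => ψ t • u t) volume 0 1 :=
    ((cψ.comp c0).smul (u.continuous.comp c0)).intervalIntegrable _ _
  have i2 : IntervalIntegrable (fun t : ℝ => φ t • v t) volume 0 1 :=
    ((cφ.comp c0).smul (v.continuous.comp c0)).intervalIntegrable _ _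
  have e3 := intervalIntegral.integral_eq_sub_of_hasDerivAt (a := (0 : ℝ)) (b := 1)
    (f := fun t : ℝ => φ t • u t) (fun t _ => (hψ t).smul (h t)) (i2.add i1)
  have e5 : ((1 : ℝ) : UnitAddCircle) = ((0 : ℝ) : UnitAddCircle) := by
    rw [AddCircle.coe_period]; rfl
  rw [intervalIntegral.integral_add i2 i1, e5, sub_self] at e3
  rw [e1, e2]
  exact eq_neg_of_add_eq_zero_right e3

theorem IsWeakDeriv.sub {n : ℕ} {x y x' y' : L2 n} (h : IsWeakDeriv x x') (h' : IsWeakDeriv y y') :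
    IsWeakDeriv (x - y) (x' - y') := fun φ ψ hφ hψ => by
  obtain ⟨L, hL⟩ := exists_testInt (n := n) (continuous_of_test hφ hψ).1
  obtain ⟨M, hM⟩ := exists_testInt (n := n) (continuous_of_test hφ hψ).2
  have h1 := h φ ψ hφ hψ
  have h2 := h' φ ψ hφ hψ
  rw [← hL, ← hM] at *
  rw [map_sub, map_sub, h1, h2]
  abel

theorem isWeakDeriv_const {n : ℕ} (c : Vec n) :
    IsWeakDeriv (toL2 (ContinuousMap.const UnitAddCircle c)) 0 := by
  have := isWeakDeriv_toL2 (u := ContinuousMap.const UnitAddCircle c) (v := 0)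
    fun t => hasDerivAt_const t c
  rwa [map_zero] at this

/-- The weak derivative has integral zero. -/
theorem IsWeakDeriv.integral_eq_zero {n : ℕ} {x y : L2 n} (h : IsWeakDeriv x y) :
    ∫ t, y t ∂haarAddCircle = 0 := by
  have := h (fun _ => 1) (fun _ => 0) contDiff_const fun t => hasDerivAt_const t 1
  simpa using this.symm

/-- A function with weak derivative zero is constant. -/
theorem exists_eq_const {n : ℕ} {w : L2 n} (h : IsWeakDeriv w 0) :
    ∃ c, w = toL2 (ContinuousMap.const UnitAddCircle c) := by
  set c := ∫ t, w t ∂haarAddCircle with hc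
  refine ⟨c, sub_eq_zero.1 (eq_zero_of_fourierCoeff fun i k => ?_)⟩
  have h' := h.sub (isWeakDeriv_const c)
  rw [sub_zero] at h'
  -- The coefficient at `0` is the mean, which has been subtracted; at `k ≠ 0` the relation `2πik ·
  -- a = 0` leaves only `a = 0`.
  by_cases hk : k = 0
  · subst hk
    set v := w - toL2 (ContinuousMap.const UnitAddCircle c) with hv
    have hint : ∫ t, v t ∂haarAddCircle = 0 := by
      have e : v =ᵐ[haarAddCircle] fun t => w t - c := by
        filter_upwards [Lp.coeFn_sub w (toL2 (ContinuousMap.const UnitAddCircle c)),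
          toL2_ae (ContinuousMap.const UnitAddCircle c)] with t h1 h2
        rw [hv, h1, Pi.sub_apply, h2]
        rfl
      rw [integral_congr_ae e, integral_sub (integrable_L2 w) (integrable_const c), ← hc]
      simp
    have := integral_complex_coord (φ := fun _ => 1) continuous_const v i
    simp only [one_mul, Complex.one_re, one_smul, Complex.one_im, zero_smul, integral_zero] at this
    simp only [fourierCoeff, neg_zero, fourier_zero, one_smul]
    rw [this, hint]
    simp
  · have e := fourierCoeff_weakDeriv h' i k
    have e0 : fourierCoeff (coord i (0 : L2 n)) k = 0 := by
      rw [fourierCoeff_eq_inner, map_zero, inner_zero_right]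
    rw [e0] at e
    have hne : (2 * Real.pi * Complex.I * k : ℂ) ≠ 0 := by
      simp [Real.pi_ne_zero, hk]
    exact (mul_eq_zero.1 e.symm).resolve_left hne

/-- Elements of `H_2` are continuously differentiable. -/
theorem hasDerivAt_rep {n : ℕ} (x : Sobolev n 2) (t : ℝ) :
    HasDerivAt (fun s : ℝ => rep (incl n 1 x) s) (rep (wderiv n 1 x) t) t := by
  set v := rep (wderiv n 1 x) with hv
  have c0 : Continuous fun t : ℝ => (t : UnitAddCircle) := AddCircle.continuous_mk' 1
  have cv : Continuous fun t : ℝ => v t := v.continuous.comp c0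
  have hw : IsWeakDeriv (fn (incl n 1 x)) (toL2 v) := by
    rw [hv, toL2_rep]
    exact isWeakDeriv_wderiv x
  have hint : ∫ t in (0 : ℝ)..1, v t = 0 := by
    rw [← integral_eq_intervalIntegral v, ← hw.integral_eq_zero]
    exact integral_congr_ae (toL2_ae v).symm
  -- A weak derivative has mean zero, which makes its primitive periodic, hence a function on the
  -- circle. It has the same weak derivative as `x`, so the two differ by a constant.
  have hper : Function.Periodic (fun t : ℝ => ∫ s in (0 : ℝ)..t, v s) 1 := fun t => by
    have hp : Function.Periodic (fun t : ℝ => v t) 1 := fun t => by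
      simp only [AddCircle.coe_add_period]
    have e1 := hp.intervalIntegral_add_eq t 0
    rw [zero_add, hint] at e1
    change ∫ s in (0 : ℝ)..t + 1, v s = ∫ s in (0 : ℝ)..t, v s
    rw [← intervalIntegral.integral_add_adjacent_intervals
      (cv.intervalIntegrable 0 t) (cv.intervalIntegrable t (t + 1)), e1, add_zero]
  have hd : ∀ t : ℝ, HasDerivAt (fun t : ℝ => ∫ s in (0 : ℝ)..t, v s) (v t) t := fun t =>
    intervalIntegral.integral_hasDerivAt_right (cv.intervalIntegrable _ _)
      cv.aestronglyMeasurable.stronglyMeasurableAtFilter cv.continuousAt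
  let z : C(UnitAddCircle, Vec n) := ⟨hper.lift, continuous_of_lift
    (continuous_iff_continuousAt.2 fun t => (hd t).continuousAt)⟩
  obtain ⟨c, hc⟩ := exists_eq_const (w := fn (incl n 1 x) - toL2 z) (by
    simpa using hw.sub (isWeakDeriv_toL2 (u := z) hd))
  have e : rep (incl n 1 x) = z + ContinuousMap.const UnitAddCircle c := by
    apply toL2_injective
    rw [toL2_rep, map_add, ← hc]
    abel
  rw [e]
  exact (hd t).add_const c

/-! ### Fourier estimates for the shift. -/

/-- Plancherel in each coordinate. The constant `K` collects the norms of `coord` and `uncoord` and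
does not depend on `c`, which later carries the dependence on the shift parameter. -/
theorem norm_le_of_coord {n : ℕ} : ∃ K : ℝ, 0 ≤ K ∧ ∀ (f g : L2 n) (c : ℝ), 0 ≤ c →
    (∀ i k, ‖fourierCoeff (coord i f) k‖ ≤ c * ‖fourierCoeff (coord i g) k‖) →
    ‖f‖ ≤ K * c * ‖g‖ := by
  refine ⟨∑ i : Fin n, ‖uncoord i‖ * ‖coord i‖,
    Finset.sum_nonneg fun i _ => by positivity, fun f g c hc h => ?_⟩
  calc ‖f‖ = ‖∑ i, uncoord i (coord i f)‖ := by rw [sum_uncoord_coord]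
    _ ≤ ∑ i, ‖uncoord i (coord i f)‖ := norm_sum_le _ _
    _ ≤ ∑ i : Fin n, (‖uncoord i‖ * ‖coord i‖) * (c * ‖g‖) := by
        refine Finset.sum_le_sum fun i _ => ?_
        have h1 := (uncoord i).le_opNorm (coord i f)
        have h2 : ‖coord i f‖ ≤ c * ‖coord i g‖ := norm_le_of_fourierCoeff hc (h i)
        have h3 := (coord i).le_opNorm g
        calc _ ≤ ‖uncoord i‖ * (c * (‖coord i‖ * ‖g‖)) := by
              refine h1.trans (mul_le_mul_of_nonneg_left (h2.trans ?_) (norm_nonneg _))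
              exact mul_le_mul_of_nonneg_left h3 hc
          _ = _ := by ring
    _ = _ := by rw [← Finset.sum_mul]; ring

/-- Translation invariance moves the shift onto the character, which is multiplicative. Estimates
for the shift thereby become scalar estimates for `exp(iθ)` with `θ = -2πkτ`. -/
theorem fourierCoeff_shiftL2 {n : ℕ} (τ : ℝ) (x : L2 n) (i : Fin n) (k : ℤ) :
    fourierCoeff (coord i (shiftL2 τ x)) k =
      Complex.exp (Complex.I * (-(2 * Real.pi * k * τ) : ℝ)) * fourierCoeff (coord i x) k := by
  have e1 : fourierCoeff (coord i (shiftL2 τ x)) k = ∫ t : UnitAddCircle,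
      (fun u => fourier (-k) (u + (τ : UnitAddCircle)) * coord i x u) (t - (τ : UnitAddCircle))
        ∂haarAddCircle := by
    refine integral_congr_ae ?_
    filter_upwards [coord_ae i (shiftL2 τ x), shiftL2_ae τ x,
      (measurePreserving_sub_right haarAddCircle (τ : UnitAddCircle)).quasiMeasurePreserving.ae
        (coord_ae i x)] with t h1 h2 h3
    simp only [sub_add_cancel, smul_eq_mul]
    rw [h1, h2, h3]
  rw [e1, integral_sub_right_eq_self (μ := haarAddCircle)
    (fun u => fourier (-k) (u + (τ : UnitAddCircle)) * coord i x u) (τ : UnitAddCircle),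
    fourierCoeff, ← integral_const_mul]
  refine integral_congr_ae (.of_forall fun t => ?_)
  have e2 : fourier (-k) (t + (τ : UnitAddCircle)) =
      fourier (-k) t * fourier (-k) (τ : UnitAddCircle) := by
    simp only [fourier_apply, smul_add, toCircle_add, Circle.coe_mul]
  have e3 : fourier (-k) (τ : UnitAddCircle) =
      Complex.exp (Complex.I * (-(2 * Real.pi * k * τ) : ℝ)) := by
    rw [fourier_coe_apply]
    congr 1
    push_cast
    ring
  simp only [smul_eq_mul, e2, e3]
  ring

theorem coord_sub_coeff {n : ℕ} (x y : L2 n) (i : Fin n) (k : ℤ) :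
    fourierCoeff (coord i (x - y)) k =
      fourierCoeff (coord i x) k - fourierCoeff (coord i y) k := by
  simp only [fourierCoeff_eq_inner, map_sub, inner_sub_right]

theorem coord_add_smul_coeff {n : ℕ} (x y : L2 n) (c : ℝ) (i : Fin n) (k : ℤ) :
    fourierCoeff (coord i (x + c • y)) k =
      fourierCoeff (coord i x) k + c * fourierCoeff (coord i y) k := by
  simp only [fourierCoeff_eq_inner, map_add, map_smul, inner_add_right]
  congr 1
  exact (inner_smul_right_eq_smul _ _ c).trans (Complex.real_smul)

theorem norm_exp_sub_one_sub_le (θ : ℝ) :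
    ‖Complex.exp (Complex.I * θ) - 1 - Complex.I * θ‖ ≤ 2 * θ ^ 2 := by
  have hn : ‖Complex.I * θ‖ = |θ| := by simp
  -- Taylor's estimate for small `θ`; for `|θ| ≥ 1` the crude bound `2|θ|` is at most `2θ²`.
  rcases le_total |θ| 1 with h | h
  · have := Complex.norm_exp_sub_one_sub_id_le (x := Complex.I * θ) (hn.trans_le h)
    rw [hn, sq_abs] at this
    nlinarith [sq_nonneg θ]
  · have h1 := Real.norm_exp_I_mul_ofReal_sub_one_le (x := θ)
    refine (norm_sub_le _ _).trans ?_
    rw [hn]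
    rw [Real.norm_eq_abs] at h1
    nlinarith [sq_abs θ]

/-- The shift is Lipschitz in the shift parameter, on `H_1`. -/
theorem norm_shiftL2_sub_le (n : ℕ) : ∃ K : ℝ, 0 ≤ K ∧ ∀ (x y : L2 n) (T : ℝ), IsWeakDeriv x y →
    ‖shiftL2 T x - x‖ ≤ K * |T| * ‖y‖ := by
  obtain ⟨K, hK, H⟩ := norm_le_of_coord (n := n)
  refine ⟨K, hK, fun x y T h => H _ _ _ (abs_nonneg T) fun i k => ?_⟩
  rw [coord_sub_coeff, fourierCoeff_shiftL2, fourierCoeff_weakDeriv h, ← sub_one_mul, norm_mul,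
    norm_mul, ← mul_assoc]
  refine mul_le_mul_of_nonneg_right (Real.norm_exp_I_mul_ofReal_sub_one_le.trans_eq ?_)
    (norm_nonneg _)
  simp
  ring

/-- The second order Taylor remainder on the Fourier side: two weak derivatives produce the factor
`(2πk)²` that absorbs `θ²`. The sign of `T • y` reflects that `x(· - T)` has derivative `-∂x` in
`T`. -/
theorem norm_shiftL2_sub_add_le (n : ℕ) : ∃ K : ℝ, 0 ≤ K ∧ ∀ (x y z : L2 n) (T : ℝ),
    IsWeakDeriv x y → IsWeakDeriv y z → ‖shiftL2 T x - x + T • y‖ ≤ K * (2 * T ^ 2) * ‖z‖ := by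
  obtain ⟨K, hK, H⟩ := norm_le_of_coord (n := n)
  refine ⟨K, hK, fun x y z T h h' => H _ _ _ (by positivity) fun i k => ?_⟩
  rw [coord_add_smul_coeff, coord_sub_coeff, fourierCoeff_shiftL2, fourierCoeff_weakDeriv h',
    fourierCoeff_weakDeriv h]
  set a := fourierCoeff (coord i x) k
  set θ : ℝ := -(2 * Real.pi * k * T) with hθ
  have e : Complex.exp (Complex.I * θ) * a - a + T * (2 * Real.pi * Complex.I * k * a) =
      (Complex.exp (Complex.I * θ) - 1 - Complex.I * θ) * a := by
    rw [hθ]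
    push_cast
    ring
  have hn : ‖(2 * Real.pi * Complex.I * k : ℂ)‖ = |2 * Real.pi * k| := by
    simp [abs_mul]
  have hn2 : ‖(2 * Real.pi * Complex.I * k : ℂ) * (2 * Real.pi * Complex.I * k * a)‖ =
      (2 * Real.pi * k) ^ 2 * ‖a‖ := by
    rw [← mul_assoc, norm_mul _ a, norm_mul, hn, abs_mul_abs_self, sq]
  rw [e, norm_mul, hn2, ← mul_assoc]
  refine mul_le_mul_of_nonneg_right ((norm_exp_sub_one_sub_le θ).trans_eq ?_) (norm_nonneg _)
  rw [hθ]
  ring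

/-- The derivative of the shift at shift parameter zero. -/
theorem isLittleO_shiftL2 {n : ℕ} (x : Sobolev n 1) :
    (fun T : ℝ => shiftL2 T (fn x) - fn x + T • fn (wderiv n 0 x)) =o[𝓝 0] fun T : ℝ => T := by
  obtain ⟨K, hK, H⟩ := norm_shiftL2_sub_le n
  obtain ⟨K', hK', H'⟩ := norm_shiftL2_sub_add_le n
  refine Asymptotics.isLittleO_iff.2 fun ε hε => ?_
  set W : Sobolev n 1 →L[ℝ] L2 n := (fn : Sobolev n 0 →L[ℝ] L2 n).comp (wderiv n 0)
  -- Approximate `x` by `z ∈ H_2`, to which the second order estimate applies. The rest `w` costs `K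
  -- |T| ‖W w‖` for the Lipschitz bound and `|T| ‖W w‖` for the derivative term, whence `K + 1`.
  have hden : 0 < (K + 1) * (‖W‖ + 1) := by positivity
  obtain ⟨z, hz⟩ := (incl_dense n 1).exists_dist_lt x (div_pos (half_pos hε) hden)
  set w := x - incl n 1 z
  have hw : (K + 1) * ‖W w‖ ≤ ε / 2 := by
    have h1 := W.le_opNorm w
    rw [dist_eq_norm, lt_div_iff₀ hden] at hz
    nlinarith [norm_nonneg w, norm_nonneg W, mul_nonneg hK (norm_nonneg w)]
  set N := ‖fn (wderiv n 0 (wderiv n 1 z))‖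
  -- For `|T|` below this radius the quadratic error of `z` is at most `|T| * (ε / 2)`.
  have hδ : 0 < ε / 2 / (K' * 2 * N + 1) := by positivity
  filter_upwards [Metric.ball_mem_nhds 0 hδ] with T hT
  rw [mem_ball_zero_iff, lt_div_iff₀ (by positivity), Real.norm_eq_abs] at hT
  have h1 := H (fn w) (W w) T (isWeakDeriv_wderiv w)
  have h2 := H' (fn (incl n 1 z)) (fn (wderiv n 1 z)) _ T (isWeakDeriv_wderiv z)
    (isWeakDeriv_wderiv (wderiv n 1 z))
  have e : shiftL2 T (fn x) - fn x + T • fn (wderiv n 0 x) =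
      (shiftL2 T (fn w) - fn w) + T • W w +
        (shiftL2 T (fn (incl n 1 z)) - fn (incl n 1 z) + T • fn (wderiv n 1 z)) := by
    have e1 : fn x = fn w + fn (incl n 1 z) := by simp [w]
    have e2 : fn (wderiv n 0 x) = W w + fn (wderiv n 1 z) := by
      have : fn (wderiv n 1 z) = W (incl n 1 z) := rfl
      rw [this, ← map_add]
      simp [w, W]
    rw [e1, e2, map_add, smul_add]
    abel
  rw [e]
  refine (norm_add₃_le).trans ?_
  rw [norm_smul, Real.norm_eq_abs]
  have hT' := abs_nonneg T
  have e3 : K' * (2 * T ^ 2) * N = |T| * (|T| * (K' * 2 * N)) := by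
    rw [← sq_abs T]; ring
  have h3 : K' * (2 * T ^ 2) * N ≤ |T| * (ε / 2) := by
    rw [e3]
    refine mul_le_mul_of_nonneg_left ?_ hT'
    nlinarith
  have h4 : K * |T| * ‖W w‖ + |T| * ‖W w‖ ≤ |T| * (ε / 2) := by
    calc _ = |T| * ((K + 1) * ‖W w‖) := by ring
      _ ≤ _ := mul_le_mul_of_nonneg_left hw hT'
  linarith

/-! ### The shift is sc-smooth. -/

/-- Composition in `L²` is jointly continuous in the function and in the measure preserving map, and
translations depend continuously on `τ` in the compact-open topology. -/
theorem continuous_shiftL2 {n : ℕ} : Continuous fun p : ℝ × L2 n => shiftL2 p.1 p.2 := by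
  have h := Lp.compMeasurePreserving_continuous (haarAddCircle : Measure UnitAddCircle)
    (haarAddCircle : Measure UnitAddCircle) (Vec n) (p := 2) (by simp)
  let F : C(ℝ × UnitAddCircle, UnitAddCircle) := ⟨fun q => q.2 - (q.1 : UnitAddCircle), by
    exact continuous_snd.sub ((AddCircle.continuous_mk' 1).comp continuous_fst)⟩
  have hc : Continuous fun p : ℝ × L2 n => (p.2, (⟨F.curry p.1,
      measurePreserving_sub_right haarAddCircle (p.1 : UnitAddCircle)⟩ :
        {f : C(UnitAddCircle, UnitAddCircle) // MeasurePreserving f haarAddCircle haarAddCircle})) :=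
    continuous_snd.prodMk ((F.curry.continuous.comp continuous_fst).subtype_mk _)
  exact h.comp hc

theorem continuous_of_components {Z : Type*} [TopologicalSpace Z] {n m : ℕ} {f : Z → Sobolev n m}
    (h : ∀ j, Continuous fun z => (f z).1 j) : Continuous f := by
  refine Continuous.subtype_mk (f := fun z => (f z).1) ?_ fun z => (f z).2
  exact (PiLp.continuous_toLp 2 _).comp (continuous_pi h)

theorem continuous_component {n m : ℕ} (j : Fin (m + 1)) :
    Continuous fun x : Sobolev n m => x.1 j :=
  ((PiLp.proj 2 (fun _ : Fin (m + 1) => L2 n) j).comp (jets n m).subtypeL).continuous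

theorem continuous_shift {Z : Type*} [TopologicalSpace Z] {n m : ℕ} {a : Z → ℝ}
    {b : Z → Sobolev n m} (ha : Continuous a) (hb : Continuous b) :
    Continuous fun z => shift (a z) (b z) :=
  continuous_of_components fun j => continuous_shiftL2.comp
    (ha.prodMk ((continuous_component j).comp hb))

/-- The identification `L² = H_0`, as an operator. -/
noncomputable def ofL2L {n : ℕ} : L2 n →L[ℝ] Sobolev n 0 where
  toFun := ofL2
  map_add' _ _ := rfl
  map_smul' _ _ := rfl
  cont := continuous_of_components fun _ => continuous_id

theorem ofL2L_fn {n : ℕ} (x : Sobolev n 0) : ofL2L (fn x) = x := fn_injective rfl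

theorem isLittleO_of_fn {n : ℕ} {Z : Type*} [NormedAddCommGroup Z] {l : Filter Z}
    {r : Z → Sobolev n 0} (h : (fun z => fn (r z)) =o[l] fun z => z) : r =o[l] fun z => z := by
  have := (ofL2L.isBigO_comp (fun z => fn (r z)) l).trans_isLittleO h
  simpa only [ofL2L_fn] using this

theorem isScLinear_wderiv (n : ℕ) : IsScLinear (E := (H n).up) (F := H n) (wderiv n 0) :=
  fun m => by
    refine ⟨wderiv n m, fun x => ?_⟩
    induction m with
    | zero => rfl
    | succ m ih => exact ih (incl n (m + 1) x)

/-- The shift `φ : ℝ × H → H`. -/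
noncomputable def shiftMap (n : ℕ) (z : ((const ℝ).prod (H n)).lvl 0) : (H n).lvl 0 :=
  shift (n := n) (m := 0) (proj₁ (const ℝ) (H n) 0 z) (proj₂ (const ℝ) (H n) 0 z)

theorem toBase_shift {n m : ℕ} (τ : ℝ) (x : Sobolev n m) :
    (H n).toBase m (shift τ x) = shift (n := n) (m := 0) τ ((H n).toBase m x) := by
  induction m with
  | zero => rfl
  | succ m ih => exact ih (incl n m x)

theorem isScContinuous_shiftMap (n : ℕ) : IsScContinuous (shiftMap n) := fun m => by
  refine ⟨fun z => shift (n := n) (m := m) (proj₁ (const ℝ) (H n) m z) (proj₂ (const ℝ) (H n) m z),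
    ?_, fun z => ?_⟩
  · exact continuous_shift (n := n) (m := m)
      (continuous_proj₁ (E := const ℝ) (F := H n) (m := m)) continuous_proj₂
  · refine (toBase_shift _ _).trans ?_
    rw [toBase_prod]
    exact congrArg (fun c : ℝ => shift (n := n) (m := 0) c
      ((H n).toBase m (proj₂ (const ℝ) (H n) m z))) (toBase_const ℝ m _).symm

theorem shiftL2_add {n : ℕ} (τ T : ℝ) (x : L2 n) :
    shiftL2 (τ + T) x = shiftL2 τ (shiftL2 T x) := by
  refine Lp.ext ?_
  filter_upwards [shiftL2_ae (τ + T) x, shiftL2_ae τ (shiftL2 T x),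
    (measurePreserving_sub_right haarAddCircle (τ : UnitAddCircle)).quasiMeasurePreserving.ae
      (shiftL2_ae T x)] with t h1 h2 h3
  rw [h1, h2, h3, AddCircle.coe_add, sub_sub]

/-- The sc-differential of the shift. -/
noncomputable def shiftDeriv (n : ℕ) (τ : ℝ) (x : Sobolev n 1) :
    ((const ℝ).prod (H n)).lvl 0 →L[ℝ] (H n).lvl 0 :=
  (shift (n := n) (m := 0) τ).comp (sndL (const ℝ) (H n) 0) -
    (ContinuousLinearMap.toSpanSingleton ℝ (shift τ (wderiv n 0 x))).comp
      (fstL (const ℝ) (H n) 0 : ((const ℝ).prod (H n)).lvl 0 →L[ℝ] ℝ)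

/-- By the group law the remainder in direction `(T, h)` is the `τ`-shift of two terms. The term
`x(· - T) - x + T ∂x` is `o(T)`. The term `h(· - T) - h` is bounded by `K |T| ‖∂h‖`, which is
quadratically small because `h` is measured in `H_1`. -/
theorem hasScDerivAt_shiftMap {n : ℕ} (z : ((const ℝ).prod (H n)).lvl 1) :
    HasScDerivAt (shiftMap n) z
      (shiftDeriv n (proj₁ (const ℝ) (H n) 1 z) (proj₂ (const ℝ) (H n) 1 z)) := by
  set τ : ℝ := proj₁ (const ℝ) (H n) 1 z with hτ
  set x : Sobolev n 1 := proj₂ (const ℝ) (H n) 1 z with hx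
  let P : ((const ℝ).prod (H n)).lvl 1 →L[ℝ] ℝ := fstL (const ℝ) (H n) 1
  let Q : ((const ℝ).prod (H n)).lvl 1 →L[ℝ] Sobolev n 1 := sndL (const ℝ) (H n) 1
  refine isLittleO_of_fn ?_
  have e : ∀ h : ((const ℝ).prod (H n)).lvl 1,
      fn ((shiftMap n (((const ℝ).prod (H n)).incl 0 (z + h)) -
        shiftMap n (((const ℝ).prod (H n)).incl 0 z) -
        shiftDeriv n τ x (((const ℝ).prod (H n)).incl 0 h) : Sobolev n 0)) =
      shiftL2 τ (shiftL2 (P h) (fn x) - fn x + P h • fn (wderiv n 0 x)) +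
        shiftL2 τ (shiftL2 (P h) (fn (Q h)) - fn (Q h)) := fun h => by
    have e1 : fn (shiftMap n (((const ℝ).prod (H n)).incl 0 (z + h)) : Sobolev n 0) =
      shiftL2 (τ + P h) (fn x + fn (Q h)) := rfl
    have e2 : fn (shiftMap n (((const ℝ).prod (H n)).incl 0 z) : Sobolev n 0) =
      shiftL2 τ (fn x) := rfl
    have e3 : fn (shiftDeriv n τ x (((const ℝ).prod (H n)).incl 0 h) : Sobolev n 0) =
      shiftL2 τ (fn (Q h)) - P h • shiftL2 τ (fn (wderiv n 0 x)) := rfl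
    have key : ∀ a b c : Sobolev n 0, fn (a - b - c) = fn a - fn b - fn c := fun a b c => by
      rw [map_sub, map_sub]
    refine (key _ _ _).trans
      ((congrArg₂ (· - ·) (congrArg₂ (· - ·) e1 e2) e3).trans ?_)
    rw [shiftL2_add]
    simp only [map_add, map_sub, map_smul]
    abel
  refine Asymptotics.IsLittleO.congr_left ?_ fun h => (e h).symm
  refine Asymptotics.IsLittleO.add ?_ ?_
  · refine ((shiftL2 τ).isBigO_comp _ _).trans_isLittleO ?_
    have h1 := (isLittleO_shiftL2 x).comp_tendsto (k := P) (l' := 𝓝 0) (by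
      simpa using P.continuous.tendsto 0)
    exact h1.trans_isBigO (P.isBigO_id _)
  · refine ((shiftL2 τ).isBigO_comp _ _).trans_isLittleO ?_
    obtain ⟨K, hK, H⟩ := norm_shiftL2_sub_le n
    let W : ((const ℝ).prod (CircleSobolev.H n)).lvl 1 →L[ℝ] L2 n :=
      (fn : Sobolev n 0 →L[ℝ] L2 n).comp ((wderiv n 0).comp Q)
    have h1 : (fun h => shiftL2 (P h) (fn (Q h)) - fn (Q h)) =O[𝓝 0] fun h => P h • W h := by
      refine Asymptotics.IsBigO.of_bound K (.of_forall fun h => ?_)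
      rw [norm_smul, ← mul_assoc]
      exact H _ _ _ (isWeakDeriv_wderiv (Q h))
    refine h1.trans_isLittleO ?_
    have h2 : (fun h => W h) =o[𝓝 0] fun _ => (1 : ℝ) :=
      (Asymptotics.isLittleO_one_iff ℝ).2 (by simpa using W.continuous.tendsto 0)
    have h3 := (P.isBigO_id (𝓝 0)).norm_right.smul_isLittleO h2
    refine h3.trans_isBigO (Asymptotics.IsBigO.of_bound 1 (.of_forall fun h => ?_))
    simp

/-- The shift is sc-smooth. -/
theorem isSc_shiftMap (k n : ℕ) : IsSc k (shiftMap n) := by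
  induction k with
  | zero => exact isScContinuous_shiftMap n
  | succ k ih =>
    let P := (const ℝ).prod (H n)
    -- The differential `φ(τ, h) - T φ(τ, ∂_t x)` consists of the shift at `(τ, h)` (`h1`), the
    -- shift at `(τ, ∂_t x)` (`h2`) and the scalar `T` (`h3`). In the tangent scale `x` lies one
    -- level higher, so `∂_t x` has the regularity that `h2` needs.
    have h1 : IsScLinear (E := P.tangent) (F := P)
        (pairL (const ℝ) (H n) 0 ((fstL (const ℝ) (H n).up 0).comp (fstL P.up P 0))
          ((sndL (const ℝ) (H n) 0).comp (sndL P.up P 0))) :=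
      ((isScLinear_fst (const ℝ) (H n).up).comp (isScLinear_fst P.up P)).pair
        ((isScLinear_snd (const ℝ) (H n)).comp (isScLinear_snd P.up P))
    have h2 : IsScLinear (E := P.tangent) (F := P)
        (pairL (const ℝ) (H n) 0 ((fstL (const ℝ) (H n).up 0).comp (fstL P.up P 0))
          ((wderiv n 0).comp ((sndL (const ℝ) (H n).up 0).comp (fstL P.up P 0)))) :=
      ((isScLinear_fst (const ℝ) (H n).up).comp (isScLinear_fst P.up P)).pair
        ((isScLinear_wderiv n).comp
          ((isScLinear_snd (const ℝ) (H n).up).comp (isScLinear_fst P.up P)))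
    have h3 : IsScLinear (E := P.tangent) (F := const ℝ)
        ((fstL (const ℝ) (H n) 0).comp (sndL P.up P 0)) :=
      (isScLinear_fst (const ℝ) (H n)).comp (isScLinear_snd P.up P)
    refine IsSc.succ_of ih hasScDerivAt_shiftMap ((ih.comp (h1.isSc k)).sub
      ((isSc_smulMap k (H n)).comp ((h3.isSc k).pair (ih.comp (h2.isSc k))))) fun x h => rfl

/-! ### Linear maps of the target and pairs of functions. -/

/-- Composition with a linear map, on `L²`. -/
noncomputable def mapL2 {p q : ℕ} (A : Vec p →L[ℝ] Vec q) : L2 p →L[ℝ] L2 q :=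
  A.compLpL 2 haarAddCircle

theorem mapL2_ae {p q : ℕ} (A : Vec p →L[ℝ] Vec q) (x : L2 p) :
    mapL2 A x =ᵐ[haarAddCircle] fun t => A (x t) :=
  ContinuousLinearMap.coeFn_compLpL _ x

theorem IsWeakDeriv.mapL2 {p q : ℕ} (A : Vec p →L[ℝ] Vec q) {x y : L2 p} (h : IsWeakDeriv x y) :
    IsWeakDeriv (mapL2 A x) (mapL2 A y) := by
  intro φ ψ hφ hψ
  have key : ∀ {φ : UnitAddCircle → ℝ}, Continuous φ → ∀ x : L2 p,
      ∫ t, φ t • CircleSobolev.mapL2 A x t ∂haarAddCircle = A (∫ t, φ t • x t ∂haarAddCircle) := by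
    intro φ hφ x
    refine Eq.trans ?_ (A.integral_comp_comm (integrable_smul hφ x))
    refine integral_congr_ae ?_
    filter_upwards [mapL2_ae A x] with t ht
    rw [ht, map_smul]
  obtain ⟨cφ, cψ⟩ := continuous_of_test hφ hψ
  rw [key cφ, key cψ, h φ ψ hφ hψ, map_neg]

/-- Composition with a linear map, on `H_m`. -/
noncomputable def mapH {p q : ℕ} (A : Vec p →L[ℝ] Vec q) (m : ℕ) :
    Sobolev p m →L[ℝ] Sobolev q m where
  toFun x := ⟨WithLp.toLp 2 fun j => mapL2 A (x.1 j), fun j => (x.2 j).mapL2 A⟩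
  map_add' x y := Subtype.ext (PiLp.ext fun j => map_add (mapL2 A) (x.1 j) (y.1 j))
  map_smul' c x := Subtype.ext (PiLp.ext fun j => map_smul (mapL2 A) c (x.1 j))
  cont := continuous_of_components fun j => (mapL2 A).continuous.comp (continuous_component j)

theorem fn_mapH {p q : ℕ} (A : Vec p →L[ℝ] Vec q) {m : ℕ} (x : Sobolev p m) :
    fn (mapH A m x) = mapL2 A (fn x) := rfl

theorem rep_mapH {p q : ℕ} (A : Vec p →L[ℝ] Vec q) (x : Sobolev p 1) (t : UnitAddCircle) :
    rep (mapH A 1 x) t = A (rep x t) := by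
  have : rep (mapH A 1 x) = (⟨A, A.continuous⟩ : C(Vec p, Vec q)).comp (rep x) := by
    apply toL2_injective
    rw [toL2_rep, fn_mapH]
    refine Lp.ext ?_
    filter_upwards [mapL2_ae A (fn x), rep_ae x,
      toL2_ae ((⟨A, A.continuous⟩ : C(Vec p, Vec q)).comp (rep x))] with t h1 h2 h3
    rw [h1, h2, h3]
    rfl
  rw [this]
  rfl

theorem isScLinear_mapH_up {p q : ℕ} (A : Vec p →L[ℝ] Vec q) :
    IsScLinear (E := (H p).up) (F := (H q).up) (mapH A 1) := fun m => by
  refine ⟨mapH A (m + 1), fun x => fn_injective (m := 1) ?_⟩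
  refine (fn_toBase_up m (mapH A (m + 1) x)).trans ?_
  exact congrArg (mapL2 A) (fn_toBase_up m x).symm

/-- The inclusion of the first factor in `ℝᵖ × ℝᵖ ≅ ℝᵖ⁺ᵖ`. -/
noncomputable def inlV (p : ℕ) : Vec p →L[ℝ] Vec (p + p) :=
  ((EuclideanSpace.finAddEquivProd : Vec (p + p) ≃L[ℝ] (Vec p × Vec p)).symm :
    (Vec p × Vec p) →L[ℝ] Vec (p + p)).comp
    (ContinuousLinearMap.inl ℝ _ _)

/-- The inclusion of the second factor in `ℝᵖ × ℝᵖ ≅ ℝᵖ⁺ᵖ`. -/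
noncomputable def inrV (p : ℕ) : Vec p →L[ℝ] Vec (p + p) :=
  ((EuclideanSpace.finAddEquivProd : Vec (p + p) ≃L[ℝ] (Vec p × Vec p)).symm :
    (Vec p × Vec p) →L[ℝ] Vec (p + p)).comp
    (ContinuousLinearMap.inr ℝ _ _)

/-- The isomorphism `ℝᵖ⁺ᵖ ≅ ℝᵖ × ℝᵖ`. -/
noncomputable def splitV (p : ℕ) : Vec (p + p) →L[ℝ] (Vec p × Vec p) :=
  (EuclideanSpace.finAddEquivProd : Vec (p + p) ≃L[ℝ] (Vec p × Vec p))

theorem splitV_add (p : ℕ) (v w : Vec p) : splitV p (inlV p v + inrV p w) = (v, w) := by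
  have h1 : splitV p (inlV p v) = (v, 0) := 
    (EuclideanSpace.finAddEquivProd : Vec (p + p) ≃L[ℝ] (Vec p × Vec p)).apply_symm_apply _
  have h2 : splitV p (inrV p w) = (0, w) := 
    (EuclideanSpace.finAddEquivProd : Vec (p + p) ≃L[ℝ] (Vec p × Vec p)).apply_symm_apply _
  rw [map_add, h1, h2]
  simp

/-- The pair of two functions, as a function to `ℝᵖ⁺ᵖ`. -/
noncomputable def combine {p m : ℕ} (x y : Sobolev p m) : Sobolev (p + p) m :=
  mapH (inlV p) m x + mapH (inrV p) m y

theorem continuous_combine {Z : Type*} [TopologicalSpace Z] {p m : ℕ} {f g : Z → Sobolev p m}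
    (hf : Continuous f) (hg : Continuous g) : Continuous fun z => combine (f z) (g z) :=
  ((mapH (inlV p) m).continuous.comp hf).add ((mapH (inrV p) m).continuous.comp hg)

theorem splitV_rep_combine {p : ℕ} (x y : Sobolev p 1) (t : UnitAddCircle) :
    splitV p (rep (combine x y) t) = (rep x t, rep y t) := by
  rw [combine, map_add, ContinuousMap.add_apply, rep_mapH, rep_mapH, splitV_add]

/-! ### Smooth maps on `S¹ × ℝᵖ` and their derivatives. -/

/-- `X : S¹ × ℝᵖ → ℝ^q` is smooth. -/
def IsSmoothMap {p q : ℕ} (X : UnitAddCircle → Vec p → Vec q) : Prop :=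
  ContDiff ℝ ∞ (fun z : ℝ × Vec p => X (z.1 : UnitAddCircle) z.2)

theorem continuous_of_lift_prod {V W : Type*} [TopologicalSpace V] [TopologicalSpace W]
    {f : UnitAddCircle × V → W} (h : Continuous fun z : ℝ × V => f ((z.1 : UnitAddCircle), z.2)) :
    Continuous f := by
  have h' : IsOpenQuotientMap (Prod.map (fun t : ℝ => (t : UnitAddCircle)) (id : V → V)) :=
    QuotientAddGroup.isOpenQuotientMap_mk.prodMap IsOpenQuotientMap.id
  exact h'.isQuotientMap.continuous_iff.2 h

namespace IsSmoothMap

variable {p q : ℕ} {X : UnitAddCircle → Vec p → Vec q}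

theorem hasFDerivAt (hX : IsSmoothMap X) (t : ℝ) (y : Vec p) :
    HasFDerivAt (X t) ((fderiv ℝ (fun z : ℝ × Vec p => X (z.1 : UnitAddCircle) z.2) (t, y)).comp
      (ContinuousLinearMap.inr ℝ ℝ (Vec p))) y := by
  have h1 := (ContDiff.differentiable hX (by simp) (t, y)).hasFDerivAt
  exact h1.comp y (hasFDerivAt_prodMk_right t y)

theorem fderiv_eq (hX : IsSmoothMap X) (t : ℝ) (y : Vec p) :
    fderiv ℝ (X t) y = (fderiv ℝ (fun z : ℝ × Vec p => X (z.1 : UnitAddCircle) z.2) (t, y)).comp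
      (ContinuousLinearMap.inr ℝ ℝ (Vec p)) := (hX.hasFDerivAt t y).fderiv

theorem differentiable (hX : IsSmoothMap X) (t : UnitAddCircle) : Differentiable ℝ (X t) := by
  induction t using QuotientAddGroup.induction_on with
  | H t => exact fun y => (hX.hasFDerivAt t y).differentiableAt

/-- A smooth map, as a continuous map. -/
noncomputable def toC (hX : IsSmoothMap X) : C(UnitAddCircle × Vec p, Vec q) :=
  ⟨fun z => X z.1 z.2, continuous_of_lift_prod (ContDiff.continuous hX)⟩

/-- The derivative in the second variable, as a continuous map. -/
noncomputable def derivC (hX : IsSmoothMap X) : C(UnitAddCircle × Vec p, Vec p →L[ℝ] Vec q) :=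
  ⟨fun z => fderiv ℝ (X z.1) z.2, continuous_of_lift_prod (by
    simp only [hX.fderiv_eq]
    exact (ContDiff.continuous_fderiv hX (by simp)).clm_comp continuous_const)⟩

theorem contDiff_fderiv (hX : IsSmoothMap X) :
    ContDiff ℝ ∞ (fderiv ℝ fun z : ℝ × Vec p => X (z.1 : UnitAddCircle) z.2) :=
  ContDiff.fderiv_right hX (by simp)

/-- The derivative in the second variable, `(t, (x, h)) ↦ dX_t(x) h`. -/
theorem deriv (hX : IsSmoothMap X) : IsSmoothMap fun t (w : Vec (p + p)) =>
    fderiv ℝ (X t) (splitV p w).1 (splitV p w).2 := by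
  simp only [IsSmoothMap, hX.fderiv_eq]
  change ContDiff ℝ ∞ fun z : ℝ × Vec (p + p) =>
    fderiv ℝ (fun z : ℝ × Vec p => X (z.1 : UnitAddCircle) z.2) (z.1, (splitV p z.2).1)
      (0, (splitV p z.2).2)
  have h2 : ContDiff ℝ ∞ fun z : ℝ × Vec (p + p) => splitV p z.2 :=
    (splitV p).contDiff.comp contDiff_snd
  exact (hX.contDiff_fderiv.comp (contDiff_fst.prodMk h2.fst)).clm_apply
    (contDiff_const.prodMk h2.snd)

/-- The total derivative along a curve, `(t, (x, v)) ↦ ∂_t X_t(x) + dX_t(x) v`. -/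
noncomputable def totalDeriv (X : UnitAddCircle → Vec p → Vec q) (t : UnitAddCircle)
    (w : Vec (p + p)) : Vec q :=
  fderiv ℝ (fun z : ℝ × Vec p => X (t + (z.1 : UnitAddCircle)) z.2) (0, (splitV p w).1)
    (1, (splitV p w).2)

/-- A point of the circle has no preferred lift, so `totalDeriv` differentiates in a real
displacement at `0`. Over a lift `t` it is the ordinary derivative at `t`, which gives smoothness.
-/
theorem totalDeriv_coe (X : UnitAddCircle → Vec p → Vec q) (t : ℝ) (w : Vec (p + p)) :
    totalDeriv X t w = fderiv ℝ (fun z : ℝ × Vec p => X (z.1 : UnitAddCircle) z.2)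
      (t, (splitV p w).1) (1, (splitV p w).2) := by
  have e : (fun z : ℝ × Vec p => X ((t : UnitAddCircle) + (z.1 : UnitAddCircle)) z.2) =
      fun z => (fun z : ℝ × Vec p => X (z.1 : UnitAddCircle) z.2) (z + (t, 0)) := by
    funext z
    simp [add_comm]
  rw [totalDeriv, e, fderiv_comp_add_right (f := fun z : ℝ × Vec p => X (z.1 : UnitAddCircle) z.2)]
  simp

theorem isSmoothMap_totalDeriv (hX : IsSmoothMap X) : IsSmoothMap (totalDeriv X) := by
  simp only [IsSmoothMap, totalDeriv_coe]
  have h2 : ContDiff ℝ ∞ fun z : ℝ × Vec (p + p) => splitV p z.2 :=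
    (splitV p).contDiff.comp contDiff_snd
  exact (hX.contDiff_fderiv.comp (contDiff_fst.prodMk h2.fst)).clm_apply
    (contDiff_const.prodMk h2.snd)

end IsSmoothMap

/-! ### The superposition operator. -/

/-- The superposition operator on continuous functions. -/
def supC {p : ℕ} {W : Type*} [TopologicalSpace W] (F : C(UnitAddCircle × Vec p, W))
    (u : C(UnitAddCircle, Vec p)) : C(UnitAddCircle, W) :=
  F.comp ((ContinuousMap.id _).prodMk u)

/-- Currying in the compact-open topology. With `W` a space of operators it gives uniform closeness
of `dX` along uniformly close curves. -/
theorem continuous_supC {p : ℕ} {W : Type*} [TopologicalSpace W]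
    (F : C(UnitAddCircle × Vec p, W)) : Continuous (supC F) := by
  refine ContinuousMap.continuous_of_continuous_uncurry _ ?_
  exact F.continuous.comp (continuous_snd.prodMk (ContinuousEval.continuous_eval))

/-- Pointwise application of a continuous family of operators. -/
noncomputable def mulC {V W : Type*} [NormedAddCommGroup V] [NormedSpace ℝ V]
    [NormedAddCommGroup W] [NormedSpace ℝ W] (A : C(UnitAddCircle, V →L[ℝ] W)) :
    C(UnitAddCircle, V) →L[ℝ] C(UnitAddCircle, W) :=
  LinearMap.mkContinuous
    { toFun := fun u => ⟨fun t => A t (u t), A.continuous.clm_apply u.continuous⟩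
      map_add' := fun u v => ContinuousMap.ext fun t => map_add (A t) (u t) (v t)
      map_smul' := fun c u => ContinuousMap.ext fun t => map_smul (A t) c (u t) } ‖A‖ fun u => by
    refine (ContinuousMap.norm_le _ (by positivity)).2 fun t => ?_
    refine ((A t).le_opNorm (u t)).trans ?_
    exact mul_le_mul (A.norm_coe_le_norm t) (u.norm_coe_le_norm t) (norm_nonneg _) (norm_nonneg A)

/-- The mean value inequality for `X_t` at each `t`, made uniform in `t` by the continuity of `u ↦
dX(u)` in the supremum norm. -/
theorem hasFDerivAt_supC {p q : ℕ} {X : UnitAddCircle → Vec p → Vec q} (hX : IsSmoothMap X)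
    (u : C(UnitAddCircle, Vec p)) :
    HasFDerivAt (supC hX.toC) (mulC (supC hX.derivC u)) u := by
  rw [hasFDerivAt_iff_isLittleO_nhds_zero, Asymptotics.isLittleO_iff]
  intro ε hε
  obtain ⟨δ, hδ, H⟩ := Metric.continuousAt_iff (f := supC hX.derivC) (a := u) |>.1
    (continuous_supC hX.derivC).continuousAt ε hε
  filter_upwards [Metric.ball_mem_nhds 0 hδ] with h hh
  rw [mem_ball_zero_iff] at hh
  refine (ContinuousMap.norm_le _ (by positivity)).2 fun t => ?_
  have key := (convex_ball (u t) δ).norm_image_sub_le_of_norm_hasFDerivWithin_le'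
    (f := X t) (f' := fderiv ℝ (X t)) (φ := fderiv ℝ (X t) (u t)) (C := ε) (x := u t)
    (y := u t + h t) (fun z _ => (hX.differentiable t z).hasFDerivAt.hasFDerivWithinAt)
    (fun z hz => ?_) (Metric.mem_ball_self hδ) ?_
  · rw [add_sub_cancel_left] at key
    exact key.trans (mul_le_mul_of_nonneg_left (h.norm_coe_le_norm t) hε.le)
  -- A point `z` near `u t` is the value at `t` of `u` translated by a constant, a curve within `δ`
  -- of `u`; so continuity at `u` compares `dX_t(z)` with `dX_t(u t)`.
  · have h1 : dist (u + ContinuousMap.const _ (z - u t)) u < δ := by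
      rw [dist_eq_norm, add_sub_cancel_left]
      refine lt_of_le_of_lt ((ContinuousMap.norm_le _ (norm_nonneg _)).2 fun _ => le_rfl)
        (mem_ball_iff_norm.1 hz)
    have h2 := (ContinuousMap.dist_apply_le_dist t).trans (H h1).le
    rw [dist_eq_norm] at h2
    simpa [supC, IsSmoothMap.derivC] using h2
  · rw [mem_ball_iff_norm, add_sub_cancel_left]
    exact (h.norm_coe_le_norm t).trans_lt hh

/-- The superposition operator `H_1 → H_0`. -/
noncomputable def nemytskii {p q : ℕ} {X : UnitAddCircle → Vec p → Vec q} (hX : IsSmoothMap X)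
    (x : (H p).up.lvl 0) : (H q).lvl 0 :=
  ofL2L (n := q) (toL2 (supC hX.toC (rep (n := p) x)))

/-- Elements of `H_2` are `C¹`, so the classical chain rule applies. The equations for `y` and `z`
allow these to be given as other images of a more regular function. -/
theorem isWeakDeriv_supC {p q : ℕ} {X : UnitAddCircle → Vec p → Vec q} (hX : IsSmoothMap X)
    (x : Sobolev p 2) {y z : Sobolev p 1} (hy : incl p 1 x = y) (hz : wderiv p 1 x = z) :
    IsWeakDeriv (toL2 (supC hX.toC (rep y)))
      (toL2 (supC hX.isSmoothMap_totalDeriv.toC (rep (combine y z)))) := by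
  subst hy hz
  refine isWeakDeriv_toL2 fun t => ?_
  have h1 := (hasDerivAt_id t).prodMk (hasDerivAt_rep x t)
  have h2 := (ContDiff.differentiable hX (by simp) (t, rep (incl p 1 x) t)).hasFDerivAt
  refine (h2.comp_hasDerivAt t h1).congr_deriv ?_
  refine Eq.trans ?_ (IsSmoothMap.totalDeriv_coe X t _).symm
  exact congrArg (fun w : Vec p × Vec p => fderiv ℝ
    (fun z : ℝ × Vec p => X (z.1 : UnitAddCircle) z.2) (t, w.1) (1, w.2))
    (splitV_rep_combine (incl p 1 x) (wderiv p 1 x) t).symm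

/-- The element of `H_{m+1}` with given underlying function and given derivative in `H_m`. -/
noncomputable def consH {n m : ℕ} (a : L2 n) (v : Sobolev n m) (h : IsWeakDeriv a (fn v)) :
    Sobolev n (m + 1) :=
  ⟨WithLp.toLp 2 (Fin.cons a v.1), fun j => by
    induction j using Fin.cases with
    | zero => exact h
    | succ j => exact v.2 j⟩

theorem toBase_up_up {n m : ℕ} (x : Sobolev n (m + 2)) :
    incl n 1 ((H n).up.up.toBase m x) = (H n).up.toBase (m + 1) x :=
  incl_toBase_up (H n).up m x

theorem wderiv_toBase_up_up {n m : ℕ} (x : Sobolev n (m + 2)) :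
    wderiv n 1 ((H n).up.up.toBase m x) = (H n).up.toBase m (wderiv n (m + 1) x) := by
  induction m with
  | zero => rfl
  | succ m ih => exact ih (incl n (m + 2) x)

theorem toBase_up_combine {p m : ℕ} (x y : Sobolev p (m + 1)) :
    (H (p + p)).up.toBase m (combine x y) =
      combine (p := p) (m := 1) ((H p).up.toBase m x) ((H p).up.toBase m y) := by
  refine fn_injective (m := 1) ?_
  refine (fn_toBase_up m _).trans ?_
  refine Eq.trans ?_ (congrArg₂ (fun a b => mapL2 (inlV p) a + mapL2 (inrV p) b)
    (fn_toBase_up m x) (fn_toBase_up m y)).symm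
  rfl

/-- For `x ∈ H_{m+2}` the pair `(x, ∂x)` lies in `H_{m+1}`, so the induction hypothesis for the
total derivative of `X` puts the weak derivative of `X(x)` in `H_m`, continuously in `x`. The
dimensions are general since each step doubles `p`. -/
theorem exists_continuous_lift {p q : ℕ} {X : UnitAddCircle → Vec p → Vec q} (hX : IsSmoothMap X)
    (m : ℕ) : ∃ g : Sobolev p (m + 1) → Sobolev q m, Continuous g ∧
      ∀ x, fn (g x) = toL2 (supC hX.toC (rep (n := p) ((H p).up.toBase m x))) := by
  have hc : ∀ m, Continuous fun x : Sobolev p (m + 1) =>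
      toL2 (supC hX.toC (rep (n := p) ((H p).up.toBase m x))) := fun m =>
    toL2.continuous.comp ((continuous_supC _).comp
      ((rep (n := p)).continuous.comp ((H p).up.toBase m).continuous))
  induction m generalizing p q with
  | zero => exact ⟨fun x => ofL2L (toL2 (supC hX.toC (rep x))), ofL2L.continuous.comp (hc 0),
      fun x => rfl⟩
  | succ m ih =>
    obtain ⟨g, hg, eg⟩ := ih hX.isSmoothMap_totalDeriv fun m =>
      toL2.continuous.comp ((continuous_supC _).comp
        ((rep (n := p + p)).continuous.comp ((H (p + p)).up.toBase m).continuous))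
    let v : Sobolev p (m + 2) → Sobolev q m := fun x =>
      g (combine (incl p (m + 1) x) (wderiv p (m + 1) x))
    have hv : Continuous v := hg.comp
      (continuous_combine (incl p (m + 1)).continuous (wderiv p (m + 1)).continuous)
    have hw : ∀ x, IsWeakDeriv (toL2 (supC hX.toC (rep (n := p) ((H p).up.toBase (m + 1) x))))
        (fn (v x)) := fun x => by
      have h := isWeakDeriv_supC hX ((H p).up.up.toBase m x) (toBase_up_up x)
        (wderiv_toBase_up_up x)
      have e : combine (p := p) (m := 1) ((H p).up.toBase (m + 1) x)
          ((H p).up.toBase m (wderiv p (m + 1) x)) =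
          (H (p + p)).up.toBase m (combine (incl p (m + 1) x) (wderiv p (m + 1) x)) :=
        (toBase_up_combine (incl p (m + 1) x) (wderiv p (m + 1) x)).symm
      rw [eg]
      exact e ▸ h
    refine ⟨fun x => consH _ (v x) (hw x), continuous_of_components fun j => ?_, fun x => rfl⟩
    induction j using Fin.cases with
    | zero => exact hc (m + 1)
    | succ j => exact (continuous_component j).comp hv

theorem isScContinuous_nemytskii {p q : ℕ} {X : UnitAddCircle → Vec p → Vec q}
    (hX : IsSmoothMap X) : IsScContinuous (E := (H p).up) (F := H q) (nemytskii hX) := fun m => by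
  obtain ⟨g, hg, eg⟩ := exists_continuous_lift hX m
  exact ⟨g, hg, fun x => fn_injective (m := 0) ((fn_toBase m (g x)).trans (eg x))⟩

/-- The sc-differential of the superposition operator. -/
noncomputable def nemytskiiDeriv {p q : ℕ} {X : UnitAddCircle → Vec p → Vec q}
    (hX : IsSmoothMap X) (x : (H p).up.lvl 1) : (H p).up.lvl 0 →L[ℝ] (H q).lvl 0 :=
  (ofL2L (n := q)).comp (toL2.comp
    ((mulC (supC hX.derivC (rep (incl p 1 x)))).comp (rep (n := p))))

/-- The operator factors as `H_2 → H_1 → C(S¹) → C(S¹) → L²`, and only the map between the spaces of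
continuous functions is nonlinear. -/
theorem hasScDerivAt_nemytskii {p q : ℕ} {X : UnitAddCircle → Vec p → Vec q}
    (hX : IsSmoothMap X) (x : (H p).up.lvl 1) :
    HasScDerivAt (E := (H p).up) (F := H q) (nemytskii hX) x (nemytskiiDeriv hX x) := by
  rw [hasScDerivAt_iff]
  have key : ∀ x : Sobolev p 2,
      HasFDerivAt (fun y : Sobolev p 2 => ofL2L (toL2 (supC hX.toC (rep (incl p 1 y)))))
        (((ofL2L (n := q)).comp toL2).comp ((mulC (supC hX.derivC (rep (incl p 1 x)))).comp
          ((rep (n := p)).comp (incl p 1)))) x := fun x => by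
    have h2 : HasFDerivAt (fun y : Sobolev p 2 => rep (incl p 1 y))
        ((rep (n := p)).comp (incl p 1)) x := ((rep (n := p)).comp (incl p 1)).hasFDerivAt
    have h3 : HasFDerivAt (fun y : Sobolev p 2 => supC hX.toC (rep (incl p 1 y)))
        ((mulC (supC hX.derivC (rep (incl p 1 x)))).comp ((rep (n := p)).comp (incl p 1))) x :=
      HasFDerivAt.comp (g := supC hX.toC) x (hasFDerivAt_supC hX (rep (incl p 1 x))) h2
    exact ((ofL2L (n := q)).comp toL2).hasFDerivAt.comp x h3
  exact key x

/-- This closes the induction on `k`: the second component of the tangent map is again a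
superposition operator, precomposed with a linear pairing. -/
theorem nemytskii_deriv_combine {p q : ℕ} {X : UnitAddCircle → Vec p → Vec q}
    (hX : IsSmoothMap X) (x : Sobolev p 2) (h : Sobolev p 1) :
    nemytskii hX.deriv (combine (incl p 1 x) h) = nemytskiiDeriv hX x h := by
  refine congrArg (fun u => ofL2L (n := q) (toL2 u)) (ContinuousMap.ext fun t => ?_)
  exact congrArg (fun w : Vec p × Vec p => fderiv ℝ (X t) w.1 w.2)
    (splitV_rep_combine (incl p 1 x) h t)

/-- The superposition operator is sc-smooth. -/
theorem isSc_nemytskii (k : ℕ) {p q : ℕ} {X : UnitAddCircle → Vec p → Vec q}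
    (hX : IsSmoothMap X) : IsSc (E := (H p).up) (F := H q) k (nemytskii hX) := by
  induction k generalizing p q with
  | zero => exact isScContinuous_nemytskii hX
  | succ k ih =>
    let E := (H p).up
    have h1 : IsScLinear (E := E.tangent) (F := (H (p + p)).up)
        (((mapH (inlV p) 1).comp ((E.incl 0).comp (fstL E.up E 0)) +
          (mapH (inrV p) 1).comp (sndL E.up E 0) :
          E.tangent.lvl 0 →L[ℝ] (H (p + p)).up.lvl 0)) :=
      ((isScLinear_mapH_up (inlV p)).comp ((isScLinear_incl E).comp (isScLinear_fst E.up E))).add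
        ((isScLinear_mapH_up (inrV p)).comp (isScLinear_snd E.up E))
    exact IsSc.succ_of (ih hX) (hasScDerivAt_nemytskii hX) ((ih hX.deriv).comp (h1.isSc k))
      (nemytskii_deriv_combine hX)

/-! ### The delay section. -/

theorem superposition_eq {n : ℕ} {X : UnitAddCircle → Vec n → Vec n} (hX : IsSmoothVectorField X)
    (x : Sobolev n 1) : superposition hX x = nemytskii (p := n) (q := n) hX x := by
  refine fn_injective (m := 0) (Lp.ext ?_)
  filter_upwards [(memLp_superposition hX x).coeFn_toLp, rep_ae x,
    toL2_ae (supC (IsSmoothMap.toC (p := n) (q := n) hX) (rep x))] with t h1 h2 h3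
  refine h1.trans (Eq.trans ?_ h3.symm)
  rw [h2]
  rfl

/-- The shift `φ : ℝ × H^1 → H^1`. -/
noncomputable def shiftMapUp (n : ℕ) (z : (delayBase n).lvl 0) : (H n).up.lvl 0 :=
  shift (n := n) (m := 1) (proj₁ (const ℝ) (H n).up 0 z) (proj₂ (const ℝ) (H n).up 0 z)

/-- The constant scale `ℝ` is its own shift, so `ℝ × H^1` is the shifted scale of `ℝ × H` and
`IsSc.up` applies. -/
theorem isSc_shiftMapUp (k n : ℕ) :
    IsSc (E := delayBase n) (F := (H n).up) k (shiftMapUp n) :=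
  IsSc.up (E := (const ℝ).prod (H n)) (F := H n) (isSc_shiftMap k n) fun _ => rfl

/-- The sc-differential of the shift `ℝ × H^1 → H^1`. -/
noncomputable def shiftDerivUp (n : ℕ) (τ : ℝ) (x : Sobolev n 2) :
    (delayBase n).lvl 0 →L[ℝ] (H n).up.lvl 0 :=
  (shift (n := n) (m := 1) τ).comp (sndL (const ℝ) (H n).up 0) -
    (ContinuousLinearMap.toSpanSingleton ℝ (shift τ (wderiv n 1 x))).comp
      (fstL (const ℝ) (H n).up 0 : (delayBase n).lvl 0 →L[ℝ] ℝ)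

theorem continuous_shift_sub_smul {Z : Type*} [TopologicalSpace Z] {n m : ℕ} {a b : Z → ℝ}
    {f : Z → Sobolev n m} {g : Z → Sobolev n (m + 1)} (ha : Continuous a) (hb : Continuous b)
    (hf : Continuous f) (hg : Continuous g) :
    Continuous fun z => shift (a z) (f z) - b z • shift (a z) (wderiv n m (g z)) :=
  (continuous_shift ha hf).sub
    (hb.smul (continuous_shift ha ((wderiv n m).continuous.comp hg)))

theorem hasScDerivAt_shiftMapUp {n : ℕ} (z : (delayBase n).lvl 1) :
    HasScDerivAt (E := delayBase n) (F := (H n).up) (shiftMapUp n) z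
      (shiftDerivUp n (proj₁ (const ℝ) (H n).up 1 z) (proj₂ (const ℝ) (H n).up 1 z)) := by
  refine HasScDerivAt.up (E := (const ℝ).prod (H n)) (F := H n) hasScDerivAt_shiftMap
    (fun _ => rfl) (D₁ := fun z : (delayBase n).lvl 1 =>
      shiftDerivUp n (proj₁ (const ℝ) (H n).up 1 z) (proj₂ (const ℝ) (H n).up 1 z))
    (fun _ _ => rfl) ?_ z
  have c1 : Continuous fun p : (delayBase n).lvl 1 × (delayBase n).lvl 0 =>
      (proj₁ (const ℝ) (H n).up 1 p.1 : ℝ) := continuous_proj₁.comp continuous_fst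
  have c2 : Continuous fun p : (delayBase n).lvl 1 × (delayBase n).lvl 0 =>
      (proj₂ (const ℝ) (H n).up 1 p.1 : Sobolev n 2) := continuous_proj₂.comp continuous_fst
  have c3 : Continuous fun p : (delayBase n).lvl 1 × (delayBase n).lvl 0 =>
      (proj₁ (const ℝ) (H n).up 0 p.2 : ℝ) := continuous_proj₁.comp continuous_snd
  have c4 : Continuous fun p : (delayBase n).lvl 1 × (delayBase n).lvl 0 =>
      (proj₂ (const ℝ) (H n).up 0 p.2 : Sobolev n 1) := continuous_proj₂.comp continuous_snd
  exact continuous_shift_sub_smul c1 c3 c4 c2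

/-- The derivative `(τ, x) ↦ ∂_t x`, on `ℝ × H^1`. -/
noncomputable def baseDeriv (n : ℕ) : (delayBase n).lvl 0 →L[ℝ] (H n).lvl 0 :=
  (wderiv n 0).comp (sndL (const ℝ) (H n).up 0)

theorem delaySection_eq {n : ℕ} {X : UnitAddCircle → Vec n → Vec n} (hX : IsSmoothVectorField X)
    (z : (delayBase n).lvl 0) : delaySection hX z = pair (delayBase n) (H n) 0 z
      (baseDeriv n z -
        nemytskii (p := n) (q := n) hX (shiftMapUp n z)) := by
  refine congrArg (pair (delayBase n) (H n) 0 z) ?_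
  exact congrArg (fun w => baseDeriv n z - w) (superposition_eq hX _)

theorem isSc_delaySection {n : ℕ} {X : UnitAddCircle → Vec n → Vec n} (hX : IsSmoothVectorField X)
    (k : ℕ) : IsSc k (delaySection hX) := by
  have h1 : IsScLinear (E := delayBase n) (F := H n)
      (baseDeriv n) :=
    (isScLinear_wderiv n).comp (isScLinear_snd (const ℝ) (H n).up)
  have h2 : IsSc (E := delayBase n) (F := H n) k fun z =>
      nemytskii (p := n) (q := n) hX (shiftMapUp n z) :=
    (isSc_nemytskii k (p := n) (q := n) hX).comp (isSc_shiftMapUp k n)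
  have h3 := ((isScLinear_id (delayBase n)).isSc k).pair ((h1.isSc k).sub h2)
  rw [funext (delaySection_eq hX)]
  exact h3

/-- The joint continuity needed for the chain rule, read off from the superposition operator of
`dX`. -/
theorem continuous_nemytskiiDeriv {n : ℕ} {X : UnitAddCircle → Vec n → Vec n}
    (hX : IsSmoothMap X) : Continuous fun z : Sobolev n 2 × Sobolev n 1 =>
      nemytskiiDeriv hX z.1 z.2 := by
  have e : (fun z : Sobolev n 2 × Sobolev n 1 => nemytskiiDeriv hX z.1 z.2) = fun z =>
      nemytskii hX.deriv (combine (incl n 1 z.1) z.2) :=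
    funext fun z => (nemytskii_deriv_combine hX z.1 z.2).symm
  rw [e]
  exact (isScContinuous_nemytskii hX.deriv).continuous.comp
    (continuous_combine ((incl n 1).continuous.comp continuous_fst) continuous_snd)

/-- The vertical sc-differential of the delay section. -/
noncomputable def delayDeriv {n : ℕ} {X : UnitAddCircle → Vec n → Vec n}
    (hX : IsSmoothVectorField X) (τ : ℝ) (x : Sobolev n 2) :
    (delayBase n).lvl 0 →L[ℝ] (H n).lvl 0 :=
  baseDeriv n -
    (nemytskiiDeriv (p := n) (q := n) hX (shift τ x)).comp (shiftDerivUp n τ x)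

theorem hasScDerivAt_nemytskii_shift {n : ℕ} {X : UnitAddCircle → Vec n → Vec n}
    (hX : IsSmoothMap X) (z : (delayBase n).lvl 1) :
    HasScDerivAt (E := delayBase n) (F := H n) (fun z => nemytskii hX (shiftMapUp n z)) z
      ((nemytskiiDeriv hX (shift (n := n) (m := 2)
        (proj₁ (const ℝ) (H n).up 1 z) (proj₂ (const ℝ) (H n).up 1 z))).comp
        (shiftDerivUp n (proj₁ (const ℝ) (H n).up 1 z) (proj₂ (const ℝ) (H n).up 1 z))) := by
  have hc : Continuous fun z : (delayBase n).lvl 1 => shift (n := n) (m := 2)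
      (proj₁ (const ℝ) (H n).up 1 z) (proj₂ (const ℝ) (H n).up 1 z) :=
    continuous_shift (n := n) (m := 2)
      (continuous_proj₁ (E := const ℝ) (F := (H n).up) (m := 1)) continuous_proj₂
  exact HasScDerivAt.comp (E := delayBase n) (F := (H n).up) (G := H n) hc (fun _ => rfl)
    (hasScDerivAt_shiftMapUp z) (hasScDerivAt_nemytskii hX) (continuous_nemytskiiDeriv hX)

theorem hasVerticalScDerivAt_delaySection {n : ℕ} {X : UnitAddCircle → Vec n → Vec n}
    (hX : IsSmoothVectorField X) (τ : ℝ) (x : Sobolev n 2) :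
    HasVerticalScDerivAt (delaySection hX) (pt 1 τ x) (delayDeriv hX τ x) := by
  have h1 := hasScDerivAt_nemytskii_shift (n := n) (X := X) hX (pt 1 τ x)
  have h2 := hasScDerivAt_linear (E := delayBase n) (F := H n) (baseDeriv n) (pt 1 τ x)
  have e : (fun q => proj₂ (delayBase n) (H n) 0 (delaySection hX q)) = fun z =>
      baseDeriv n z - nemytskii (p := n) (q := n) hX (shiftMapUp n z) :=
    funext fun z => congrArg (proj₂ (delayBase n) (H n) 0) (delaySection_eq hX z)
  unfold HasVerticalScDerivAt
  rw [e]
  exact h2.sub h1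

/-- The chain rule applies `-dX(φ(τ, x))` to `φ(τ, x') - T φ(τ, ∂_t x)`, which explains the plus
sign of the last term. Pointwise values are compared through continuous representatives. -/
theorem fn_delayDeriv_ae {n : ℕ} {X : UnitAddCircle → Vec n → Vec n}
    (hX : IsSmoothVectorField X) (τ : ℝ) (x : Sobolev n 2) (T : ℝ) (x' : Sobolev n 1) :
    fn (delayDeriv hX τ x (pt 0 T x') : Sobolev n 0) =ᵐ[haarAddCircle] fun t =>
      fn (wderiv n 0 x') t - fderiv ℝ (X t) (fn (shift τ x) t) (fn (shift τ x') t)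
        + T • fderiv ℝ (X t) (fn (shift τ x) t) (fn (shift τ (wderiv n 1 x)) t) := by
  set w := supC (IsSmoothMap.derivC (p := n) (q := n) hX) (rep (incl n 1 (shift τ x)))
  set v : Sobolev n 1 := shift τ x' - T • shift τ (wderiv n 1 x)
  have e : fn (delayDeriv hX τ x (pt 0 T x') : Sobolev n 0) =
      fn (wderiv n 0 x') - toL2 (mulC w (rep v)) := rfl
  have hr : fn (shift τ x) =ᵐ[haarAddCircle] rep (incl n 1 (shift τ x)) :=
    rep_ae (incl n 1 (shift τ x))
  rw [e]
  filter_upwards [Lp.coeFn_sub (fn (wderiv n 0 x')) (toL2 (mulC w (rep v))),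
    toL2_ae (mulC w (rep v)), hr, rep_ae (shift τ x'),
    rep_ae (shift τ (wderiv n 1 x))] with t h1 h2 h3 h4 h5
  have h6 : mulC w (rep v) t = fderiv ℝ (X t) (rep (incl n 1 (shift τ x)) t)
      (rep (shift τ x') t - T • rep (shift τ (wderiv n 1 x)) t) := by
    have : rep v = rep (shift τ x') - T • rep (shift τ (wderiv n 1 x)) := by
      rw [map_sub, map_smul]
    rw [this]
    rfl
  rw [h1, Pi.sub_apply, h2, h3, h4, h5, h6, map_sub, map_smul]
  abel

theorem shift_zero {n m : ℕ} (x : Sobolev n m) : shift 0 x = x := by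
  refine fn_injective (Lp.ext ?_)
  filter_upwards [fn_shift_ae 0 x] with t ht
  rw [ht, AddCircle.coe_zero, sub_zero]

end CircleSobolev


theorem mainTheorem3 (n : ℕ) (X : UnitAddCircle → Vec n → Vec n) (hX : IsSmoothVectorField X) :
    ScHilbertSpace.IsSection (delaySection hX) ∧
    ScHilbertSpace.IsScSmooth (delaySection hX) ∧
    (∀ (τ : ℝ) (x : Sobolev n 2), ∃ D : (delayBase n).lvl 0 →L[ℝ] (H n).lvl 0,
      ScHilbertSpace.HasVerticalScDerivAt (delaySection hX) (pt 1 τ x) D ∧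
      ∀ (T : ℝ) (x' : Sobolev n 1),
        fn (D (pt 0 T x') : Sobolev n 0) =ᵐ[AddCircle.haarAddCircle] fun t =>
          fn (wderiv n 0 x') t - fderiv ℝ (X t) (fn (shift τ x) t) (fn (shift τ x') t)
            + T • fderiv ℝ (X t) (fn (shift τ x) t) (fn (shift τ (wderiv n 1 x)) t)) ∧
    (∀ x : Sobolev n 2, ∃ D : (delayBase n).lvl 0 →L[ℝ] (H n).lvl 0,
      ScHilbertSpace.HasVerticalScDerivAt (delaySection hX) (pt 1 0 x) D ∧
      ∀ (T : ℝ) (x' : Sobolev n 1),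
        fn (D (pt 0 T x') : Sobolev n 0) =ᵐ[AddCircle.haarAddCircle] fun t =>
          fn (wderiv n 0 x') t - fderiv ℝ (X t) (fn x t) (fn x' t)
            + T • fderiv ℝ (X t) (fn x t) (fn (wderiv n 1 x) t)) := by
  refine ⟨fun _ => rfl, isSc_delaySection hX, fun τ x => ⟨delayDeriv hX τ x,
    hasVerticalScDerivAt_delaySection hX τ x, fn_delayDeriv_ae hX τ x⟩, fun x =>
    ⟨delayDeriv hX 0 x, hasVerticalScDerivAt_delaySection hX 0 x, fun T x' => ?_⟩⟩
  have h := fn_delayDeriv_ae hX 0 x T x'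
  simp only [shift_zero] at h
  exact h
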